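/- Let $G=BS(1,2)=\langle a,b\mid a^{b}=a^{2}\rangle$, where $g^{x}=x^{-1}gx$. A total order $\le$ on $G$ makes $G$ an ordered group if $g\le h$ implies $xgy\le xhy$ for all $g,h,x,y\in G$. Such an order on $G$ exists. For every such order $\le$ and every finite subset $S$ of $G$ that generates $G$, with $S^2=\{st : s,t\in S\}$, the following hold. (i) If $|S|=k>4$, then $|S^2|=3|S|-2$ if and only if there are $x,c\in G$ with $c>1$ and either $c^{x}=c^{2}$ or $(c^{2})^{x}=c$ such that $S=\{x,xc,\dots,xc^{k-1}\}$. (ii) If $|S|=4$, then $|S^2|=3|S|-2$ if and only if either $S=\{1,c,c^2,x\}$ for some $x,c\in G$ with $c^{x}=c^{2}$ or $(c^{2})^{x}=c$, or $S=\{x,xc,xc^2,xc^3\}$ for some $x,c\in G$ with $c>1$ and either $c^{x}=c^{2}$ or $(c^{2})^{x}=c$. -/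

import Mathlib

open scoped Pointwise

/-- The Baumslag-Solitar group `BS(1,2) = ⟨a, b | a ^ b = a ^ 2⟩`, where `a ^ b = b⁻¹ a b`;
the generators `a`, `b` are the images of the free generators `0`, `1`. -/
abbrev BS12 : Type :=
  PresentedGroup
    ({(FreeGroup.of 1)⁻¹ * FreeGroup.of 0 * FreeGroup.of 1 * (FreeGroup.of 0 ^ 2)⁻¹} :
      Set (FreeGroup (Fin 2)))

/-- The conjugate `g ^ x = x⁻¹ g x`. -/
def conjBy {G : Type*} [Group G] (g x : G) : G := x⁻¹ * g * x

/-- A total order `o` makes the group `G` an ordered group: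
`a ≤ b` implies `x a y ≤ x b y` for all `x`, `y`. -/
def IsGroupOrder {G : Type*} [Group G] (o : LinearOrder G) : Prop :=
  ∀ a b x y : G, o.le a b → o.le (x * a * y) (x * b * y)

/-- The set `{x, x c, x c ^ 2, …, x c ^ (k - 1)}`. -/
def geomProg {G : Type*} [Group G] (x c : G) (k : ℕ) : Set G :=
  {g | ∃ i : ℕ, i < k ∧ g = x * c ^ i}

/-- The relation `c ^ x = c ^ 2` or `(c ^ 2) ^ x = c`, exponents in `x` denoting conjugation. -/
def DoublingRel {G : Type*} [Group G] (c x : G) : Prop :=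
  conjBy c x = c ^ 2 ∨ conjBy (c ^ 2) x = c

/-! BS(1,2) acts faithfully on the rational line by `a : z ↦ z + 1`, `b : z ↦ z / 2`, so the problem
moves to finite noncommutative sets `S` in the group `RatAff` of maps `z ↦ s z + t` with `s > 0`.
Ordering pairs (scale, shift) lexicographically makes this an ordered group. Moreover, two elements
that commute with the same nontrivial element commute with each other. The order `o` of the
statement only decides whether a progression is written with ratio `c` or `c⁻¹`.

Lower bound (`three_mul_card_le`): a new maximum added to a noncommutative set creates at least
three products (`card_mul_insert_max`). If the remaining set `T` is commutative, then `T * T`, `m T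
∪ T m` and `m²` are disjoint, of sizes at least `2|T| - 1`, `|T| + 1` and `1`. Either way `|S²| ≥
3|S| - 2`.

Equality for four elements (`isProg_or_isTri_of_card_four`): products are counted scale by scale.
Every pattern of scales gives at least 11 products, except four equal scales and three equal scales
with one other. In the first, the shifts of the products are the sums `u i + s * u j`, and having
only ten of them forces equal gaps and `s = 2` or `1 / 2`. In the second, the triple has scale 1,
and having ten products forces it to be `1, c, c²`, with the fourth scale equal to 2 or 1/2.

Equality for more elements (`classified`): deleting the maximum or the minimum of an extremal set
leaves an extremal noncommutative set. Two overlapping progressions glue together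
(`isProg_of_erase`), and the exceptional shape does not extend to five elements
(`not_isTri_erase_max`). -/

/-- The orientation-preserving affine maps `z ↦ scale * z + shift` of the rational line. -/
@[ext] structure RatAff where
  scale : ℚ
  shift : ℚ
  scale_pos : 0 < scale

/-! ### The ordered group of rational affine maps. -/

namespace RatAff

instance : Mul RatAff :=
  ⟨fun x y => ⟨x.scale * y.scale, x.shift + x.scale * y.shift, mul_pos x.scale_pos y.scale_pos⟩⟩
instance : One RatAff := ⟨⟨1, 0, one_pos⟩⟩
instance : Inv RatAff :=
  ⟨fun x => ⟨x.scale⁻¹, -(x.scale⁻¹ * x.shift), inv_pos.2 x.scale_pos⟩⟩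

@[simp] lemma scale_mul (x y : RatAff) : (x * y).scale = x.scale * y.scale := rfl
@[simp] lemma shift_mul (x y : RatAff) : (x * y).shift = x.shift + x.scale * y.shift := rfl
@[simp] lemma scale_one : (1 : RatAff).scale = 1 := rfl
@[simp] lemma shift_one : (1 : RatAff).shift = 0 := rfl
@[simp] lemma scale_inv (x : RatAff) : x⁻¹.scale = x.scale⁻¹ := rfl
@[simp] lemma shift_inv (x : RatAff) : x⁻¹.shift = -(x.scale⁻¹ * x.shift) := rfl

lemma scale_ne_zero (x : RatAff) : x.scale ≠ 0 := x.scale_pos.ne'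

instance : Group RatAff :=
  Group.ofLeftAxioms
    (fun x y z => by ext <;> simp <;> ring)
    (fun x => by ext <;> simp)
    (fun x => by
      have := x.scale_ne_zero
      ext <;> simp [this])

instance : LinearOrder RatAff :=
  LinearOrder.lift' (fun x : RatAff => toLex (x.scale, x.shift)) (fun x y h => by
    have h' := toLex.injective h
    simp only [Prod.mk.injEq] at h'
    exact RatAff.ext h'.1 h'.2)

lemma lt_iff (x y : RatAff) :
    x < y ↔ x.scale < y.scale ∨ x.scale = y.scale ∧ x.shift < y.shift := by
  change toLex (x.scale, x.shift) < toLex (y.scale, y.shift) ↔ _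
  rw [Prod.Lex.toLex_lt_toLex]

instance : MulLeftStrictMono RatAff := ⟨fun z x y h => by
  have hz := z.scale_pos
  simp only [lt_iff, scale_mul, shift_mul] at h ⊢
  rcases h with h | ⟨h, h'⟩
  · left; gcongr
  · right; exact ⟨by rw [h], by gcongr⟩⟩

instance : MulRightStrictMono RatAff := ⟨fun z x y h => by
  have hz := z.scale_pos
  change x * z < y * z
  simp only [lt_iff, scale_mul, shift_mul] at h ⊢
  rcases h with h | ⟨h, h'⟩
  · left; gcongr
  · right; exact ⟨by rw [h], by rw [h]; gcongr⟩⟩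

instance : MulLeftMono RatAff := ⟨fun z x y h => by
  rcases h.lt_or_eq with h | rfl
  · exact (mul_lt_mul_right h z).le
  · exact le_rfl⟩

instance : MulRightMono RatAff := ⟨fun z x y h => by
  rcases h.lt_or_eq with h | rfl
  · exact (mul_lt_mul_left h z).le
  · exact le_rfl⟩

lemma commute_iff (x y : RatAff) :
    Commute x y ↔ (x.scale - 1) * y.shift = (y.scale - 1) * x.shift := by
  rw [commute_iff_eq, RatAff.ext_iff]
  simp only [scale_mul, shift_mul]
  constructor
  · rintro ⟨-, h⟩; linear_combination h
  · intro h; exact ⟨mul_comm _ _, by linear_combination h⟩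

/-- Commuting is transitive through nontrivial elements. -/
lemma commute_trans {x y z : RatAff} (hx : x ≠ 1) (hy : Commute x y) (hz : Commute x z) :
    Commute y z := by
  rw [commute_iff] at *
  by_cases h : x.scale = 1
  · have hs : x.shift ≠ 0 := fun h0 => hx (RatAff.ext h h0)
    simp only [h, sub_self, zero_mul, zero_eq_mul, hs, or_false] at hy hz
    rw [hy, hz]; ring
  · have h' : x.scale - 1 ≠ 0 := sub_ne_zero.2 h
    apply mul_left_cancel₀ h'
    linear_combination (y.scale - 1) * hz - (z.scale - 1) * hy

/-- An ordered group has no torsion, so `x * x` is nontrivial when `x` is, and both `x` and `y`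
commute with it. -/
lemma commute_of_sq {x y : RatAff} (h : Commute (x * x) y) : Commute x y := by
  by_cases hx : x = 1
  · rw [hx]; exact Commute.one_left y
  have hx2 : x * x ≠ 1 := by
    intro h
    rcases lt_or_gt_of_ne hx with h1 | h1
    · exact absurd h (Left.mul_lt_one h1 h1).ne
    · exact absurd h (Left.one_lt_mul h1 h1).ne'
  exact commute_trans hx2 ((Commute.refl x).mul_left (Commute.refl x)) h

end RatAff

/-! ### The lower bound `3 |S| - 2`. -/

namespace RatAff
open Finset

/-- Some two elements of `S` do not commute. -/
def Noncomm (S : Finset RatAff) : Prop := ∃ x ∈ S, ∃ y ∈ S, ¬ Commute x y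

lemma not_noncomm {S : Finset RatAff} : ¬ Noncomm S ↔ ∀ x ∈ S, ∀ y ∈ S, Commute x y := by
  simp [Noncomm]

lemma card_add_three_le {α : Type*} [DecidableEq α] {X Y : Finset α} (h : Y ⊆ X) {a b c : α}
    (ha : a ∈ X) (hb : b ∈ X) (hc : c ∈ X) (ha' : a ∉ Y) (hb' : b ∉ Y) (hc' : c ∉ Y)
    (hab : a ≠ b) (hac : a ≠ c) (hbc : b ≠ c) : #Y + 3 ≤ #X := by
  have h1 : insert a (insert b (insert c Y)) ⊆ X := by
    simp only [insert_subset_iff]; exact ⟨ha, hb, hc, h⟩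
  have h2 := card_le_card h1
  rw [card_insert_of_notMem, card_insert_of_notMem, card_insert_of_notMem hc'] at h2
  · omega
  · simp [hbc, hb']
  · simp [hab, hac, ha']

/-- The largest element of `T` not commuting with `m`. -/
lemma exists_max_not_commute {T : Finset RatAff} {m : RatAff} (h : ∃ t ∈ T, ¬ Commute m t) :
    ∃ j ∈ T, ¬ Commute m j ∧ ∀ t ∈ T, j < t → Commute m t := by
  classical
  obtain ⟨t, ht, hmt⟩ := h
  have hne : (T.filter (fun t => ¬ Commute m t)).Nonempty := ⟨t, by simp [ht, hmt]⟩
  have hmem := max'_mem _ hne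
  rw [mem_filter] at hmem
  refine ⟨_, hmem.1, hmem.2, fun t ht hlt => ?_⟩
  by_contra hc
  exact absurd (le_max' _ t (mem_filter.2 ⟨ht, hc⟩)) (not_le.2 hlt)

lemma mul_lt_of_lt_le {a b c d : RatAff} (h : a < c) (h' : b ≤ d) : a * b < c * d :=
  (mul_lt_mul_left h b).trans_le (mul_le_mul_right h' c)

lemma mul_lt_of_le_lt {a b c d : RatAff} (h : a ≤ c) (h' : b < d) : a * b < c * d :=
  (mul_lt_mul_right h' a).trans_le (mul_le_mul_left h d)

/-- Adding a new maximum to a noncommutative set adds at least three products. -/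
theorem card_mul_insert_max {T : Finset RatAff} (hT : Noncomm T) {m : RatAff}
    (hm : ∀ t ∈ T, t < m) : #(T * T) + 3 ≤ #(insert m T * insert m T) := by
  have hsub : T * T ⊆ insert m T * insert m T :=
    mul_subset_mul (subset_insert _ _) (subset_insert _ _)
  have hmS : m ∈ insert m T := mem_insert_self _ _
  have hTS : ∀ {t}, t ∈ T → t ∈ insert m T := fun h => mem_insert_of_mem h
  have hne : T.Nonempty := by obtain ⟨x, hx, -⟩ := hT; exact ⟨x, hx⟩
  obtain ⟨t, htT, htmax⟩ : ∃ t ∈ T, ∀ x ∈ T, x ≤ t :=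
    ⟨T.max' hne, T.max'_mem hne, fun x hx => T.le_max' x hx⟩
  have htm := hm t htT
  by_cases hc : ∃ t ∈ T, ¬ Commute m t
  · obtain ⟨j, hjT, hj, hjmax⟩ := exists_max_not_commute hc
    have h1 : m * m ∉ T * T := by
      intro h
      obtain ⟨a, ha, b, hb, hab⟩ := mem_mul.1 h
      exact (mul_lt_of_lt_le (hm a ha) (hm b hb).le).ne hab
    have h2 : m * t ∉ T * T := by
      intro h
      obtain ⟨a, ha, b, hb, hab⟩ := mem_mul.1 h
      exact (mul_lt_of_lt_le (hm a ha) (htmax b hb)).ne hab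
    have h3 : t * m ∉ T * T := by
      intro h
      obtain ⟨a, ha, b, hb, hab⟩ := mem_mul.1 h
      exact (mul_lt_of_le_lt (htmax a ha) (hm b hb)).ne hab
    have hmt : m * m ≠ m * t := (mul_lt_mul_right htm m).ne'
    have htm' : m * m ≠ t * m := (mul_lt_mul_left htm m).ne'
    rcases (htmax j hjT).lt_or_eq with hjt | rfl
    · have hct := hjmax t htT hjt
      -- When `t` commutes with `m`, the products `m t` and `t m` coincide and a third new one is
      -- needed. The larger of `m j` and `j m` serves: factors `a, b ∈ T` of it would both exceed
      -- `j`, hence commute with `m`, and then so would `j`.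
      have key : ∃ y, (y = m * j ∨ y = j * m) ∧ y ∉ T * T := by
        rcases le_total (m * j) (j * m) with hle | hle
        · refine ⟨j * m, Or.inr rfl, fun h => ?_⟩
          obtain ⟨a, ha, b, hb, hab⟩ := mem_mul.1 h
          have hja : j < a := by
            by_contra hja
            exact (mul_lt_of_le_lt (not_lt.1 hja) (hm b hb)).ne hab
          have hjb : j < b := by
            by_contra hjb
            exact ((mul_lt_of_lt_le (hm a ha) (not_lt.1 hjb)).trans_le hle).ne hab
          have hcm : Commute m (j * m) := by
            rw [← hab]; exact (hjmax a ha hja).mul_right (hjmax b hb hjb)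
          apply hj
          have := hcm.eq
          rw [← mul_assoc] at this
          exact mul_right_cancel this
        · refine ⟨m * j, Or.inl rfl, fun h => ?_⟩
          obtain ⟨a, ha, b, hb, hab⟩ := mem_mul.1 h
          have hja : j < a := by
            by_contra hja
            exact ((mul_lt_of_le_lt (not_lt.1 hja) (hm b hb)).trans_le hle).ne hab
          have hjb : j < b := by
            by_contra hjb
            exact (mul_lt_of_lt_le (hm a ha) (not_lt.1 hjb)).ne hab
          have hcm : Commute m (m * j) := by
            rw [← hab]; exact (hjmax a ha hja).mul_right (hjmax b hb hjb)
          apply hj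
          have := hcm.eq
          rw [mul_assoc] at this
          exact mul_left_cancel this
      obtain ⟨y, hy, hyT⟩ := key
      have hyc : ¬ Commute m y := by
        rcases hy with rfl | rfl
        · intro h; apply hj
          have := h.eq
          rw [mul_assoc] at this
          exact mul_left_cancel this
        · intro h; apply hj
          have := h.eq
          rw [← mul_assoc] at this
          exact mul_right_cancel this
      have hyS : y ∈ insert m T * insert m T := by
        rcases hy with rfl | rfl
        · exact mul_mem_mul hmS (hTS hjT)
        · exact mul_mem_mul (hTS hjT) hmS
      refine card_add_three_le hsub (mul_mem_mul hmS hmS) (mul_mem_mul hmS (hTS htT)) hyS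
        h1 h2 hyT hmt ?_ ?_
      · rintro rfl; exact hyc ((Commute.refl m).mul_right (Commute.refl m))
      · rintro rfl; exact hyc ((Commute.refl m).mul_right hct)
    · exact card_add_three_le hsub (mul_mem_mul hmS hmS) (mul_mem_mul hmS (hTS htT))
        (mul_mem_mul (hTS htT) hmS) h1 h2 h3 hmt htm' hj
  · push Not at hc
    -- Only the identity commutes with a whole noncommutative set. With `m = 1`, all of `T` lies
    -- below 1 and every product in `T * T` lies below both its factors, so `1`, `t` and the largest
    -- `j` not commuting with `t` are new.
    have hm1 : m = 1 := by
      by_contra hm1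
      obtain ⟨x, hx, y, hy, hxy⟩ := hT
      exact hxy (commute_trans hm1 (hc x hx) (hc y hy))
    subst hm1
    have hc' : ∃ x ∈ T, ¬ Commute t x := by
      by_contra! h
      obtain ⟨x, hx, y, hy, hxy⟩ := hT
      exact hxy (commute_trans htm.ne (h x hx) (h y hy))
    obtain ⟨j, hjT, hj, hjmax⟩ := exists_max_not_commute hc'
    have hlt : ∀ {a b}, a ∈ T → b ∈ T → a * b < a ∧ a * b < b := by
      intro a b ha hb
      exact ⟨by simpa using mul_lt_mul_right (hm b hb) a,
        by simpa using mul_lt_mul_left (hm a ha) b⟩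
    have h1 : (1 : RatAff) ∉ T * T := by
      intro h
      obtain ⟨a, ha, b, hb, hab⟩ := mem_mul.1 h
      exact ((hlt ha hb).1.trans (hm a ha)).ne hab
    have h2 : t ∉ T * T := by
      intro h
      obtain ⟨a, ha, b, hb, hab⟩ := mem_mul.1 h
      exact ((hlt ha hb).1.trans_le (htmax a ha)).ne hab
    have h3 : j ∉ T * T := by
      intro h
      obtain ⟨a, ha, b, hb, hab⟩ := mem_mul.1 h
      apply hj
      rw [← hab]
      exact (hjmax a ha (hab ▸ (hlt ha hb).1)).mul_right (hjmax b hb (hab ▸ (hlt ha hb).2))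
    have hS : ∀ {x}, x ∈ insert 1 T → x ∈ insert 1 T * insert 1 T := fun {x} hx => by
      have := mul_mem_mul hmS hx
      rwa [one_mul] at this
    exact card_add_three_le hsub (hS hmS) (hS (hTS htT)) (hS (hTS hjT)) h1 h2 h3
      htm.ne' (hm j hjT).ne' (by rintro rfl; exact hj (Commute.refl t))

/-- Splitting the products of `T ∪ {m}` by the degree in `m`, for commutative `T`. -/
lemma card_mul_insert_of_commute {T : Finset RatAff} (hT : ∀ x ∈ T, ∀ y ∈ T, Commute x y)
    {m : RatAff} (hm : ∃ t ∈ T, ¬ Commute m t) :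
    #(T * T) + #({m} * T ∪ T * {m}) + 1 ≤ #(insert m T * insert m T) := by
  obtain ⟨t, ht, hmt⟩ := hm
  have ht1 : t ≠ 1 := by rintro rfl; exact hmt (Commute.one_right m)
  have hd : Disjoint (T * T) ({m} * T ∪ T * {m}) := by
    rw [disjoint_left]
    intro z hz hz'
    obtain ⟨a, ha, b, hb, rfl⟩ := mem_mul.1 hz
    have hc : Commute t (a * b) := (hT t ht a ha).mul_right (hT t ht b hb)
    rcases mem_union.1 hz' with h | h
    · obtain ⟨m', hm', c, hcT, h'⟩ := mem_mul.1 h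
      rw [mem_singleton] at hm'; subst hm'
      have : m' = a * b * c⁻¹ := by rw [← h']; group
      apply hmt; rw [this]
      exact (hc.mul_right (hT t ht c hcT).inv_right).symm
    · obtain ⟨c, hcT, m', hm', h'⟩ := mem_mul.1 h
      rw [mem_singleton] at hm'; subst hm'
      have : m' = c⁻¹ * (a * b) := by rw [← h']; group
      apply hmt; rw [this]
      exact ((hT t ht c hcT).inv_right.mul_right hc).symm
  have hmm : m * m ∉ T * T ∪ ({m} * T ∪ T * {m}) := by
    have hmT : m ∉ T := fun h => hmt (hT m h t ht)
    simp only [mem_union, not_or]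
    refine ⟨fun h => ?_, fun h => ?_, fun h => ?_⟩
    · obtain ⟨a, ha, b, hb, h⟩ := mem_mul.1 h
      apply hmt
      apply commute_of_sq
      rw [← h]
      exact ((hT t ht a ha).mul_right (hT t ht b hb)).symm
    · obtain ⟨m', hm', c, hcT, h⟩ := mem_mul.1 h
      rw [mem_singleton] at hm'; subst hm'
      exact hmT (mul_left_cancel h ▸ hcT)
    · obtain ⟨c, hcT, m', hm', h⟩ := mem_mul.1 h
      rw [mem_singleton] at hm'; subst hm'
      exact hmT (mul_right_cancel h ▸ hcT)
  rw [← card_union_of_disjoint hd, ← card_insert_of_notMem hmm]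
  apply card_le_card
  have hsT : T ⊆ insert m T := subset_insert _ _
  have hsm : {m} ⊆ insert m T := by simp
  rw [insert_subset_iff]
  refine ⟨mul_mem_mul (mem_insert_self _ _) (mem_insert_self _ _), union_subset ?_
    (union_subset ?_ ?_)⟩
  · exact mul_subset_mul hsT hsT
  · exact mul_subset_mul hsm hsT
  · exact mul_subset_mul hsT hsm

/-- Otherwise `m T = T m`. For the largest `j ∈ T` not commuting with `m`, say with `m j < j m`, one
has `j m = m c` with `c > j`; then `c` commutes with `m`, so `j = c`, a contradiction. -/
lemma card_add_one_le_card_mul_union {T : Finset RatAff} {m : RatAff}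
    (hm : ∃ t ∈ T, ¬ Commute m t) : #T + 1 ≤ #({m} * T ∪ T * {m}) := by
  by_contra! h
  obtain ⟨j, hjT, hj, hjmax⟩ := exists_max_not_commute hm
  have h1 : {m} * T = {m} * T ∪ T * {m} :=
    eq_of_subset_of_card_le subset_union_left (by rw [card_singleton_mul]; omega)
  have h2 : T * {m} = {m} * T ∪ T * {m} :=
    eq_of_subset_of_card_le subset_union_right (by rw [card_mul_singleton]; omega)
  rcases lt_trichotomy (m * j) (j * m) with hlt | heq | hlt
  · have : j * m ∈ {m} * T := by
      rw [h1, ← h2]; exact mul_mem_mul hjT (mem_singleton_self m)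
    obtain ⟨m', hm', c, hc, h⟩ := mem_mul.1 this
    rw [mem_singleton] at hm'; subst hm'
    have hjc : j < c := by rw [← h] at hlt; exact lt_of_mul_lt_mul_left' hlt
    have := (hjmax c hc hjc).eq
    rw [this] at h
    exact hjc.ne' (mul_right_cancel h)
  · exact hj heq
  · have : m * j ∈ T * {m} := by
      rw [h2, ← h1]; exact mul_mem_mul (mem_singleton_self m) hjT
    obtain ⟨c, hc, m', hm', h⟩ := mem_mul.1 this
    rw [mem_singleton] at hm'; subst hm'
    have hjc : j < c := by rw [← h] at hlt; exact lt_of_mul_lt_mul_right' hlt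
    have := (hjmax c hc hjc).eq
    rw [← this] at h
    exact hjc.ne' (mul_left_cancel h)

lemma two_mul_card_le_card_mul {T : Finset RatAff} : 2 * #T ≤ #(T * T) + 1 := by
  rcases T.eq_empty_or_nonempty with rfl | h
  · simp
  · have := cauchy_davenport_mul_of_linearOrder_isCancelMul h h
    omega

lemma exists_not_commute_of_insert {T : Finset RatAff} {m : RatAff} (h : Noncomm (insert m T))
    (hT : ∀ x ∈ T, ∀ y ∈ T, Commute x y) : ∃ t ∈ T, ¬ Commute m t := by
  by_contra! hc
  obtain ⟨x, hx, y, hy, hxy⟩ := h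
  rcases mem_insert.1 hx with hx | hx <;> rcases mem_insert.1 hy with hy | hy
  · rw [hx, hy] at hxy; exact hxy (Commute.refl _)
  · rw [hx] at hxy; exact hxy (hc y hy)
  · rw [hy] at hxy; exact hxy (hc x hx).symm
  · exact hxy (hT x hx y hy)

/-- A noncommutative finite set has at least `3 * #S - 2` products. -/
theorem three_mul_card_le {S : Finset RatAff} (hS : Noncomm S) : 3 * #S ≤ #(S * S) + 2 := by
  induction S using Finset.induction_on_max with
  | empty => simp
  | insert m T hm ih =>
    have hmT : m ∉ T := fun h => (hm m h).false
    rw [card_insert_of_notMem hmT]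
    by_cases hT : Noncomm T
    · have h1 := ih hT
      have h2 := card_mul_insert_max hT hm
      omega
    · rw [not_noncomm] at hT
      have hc := exists_not_commute_of_insert hS hT
      -- The count is `(2|T| - 1) + (|T| + 1) + 1 = 3 (|T| + 1) - 2`.
      have h1 := card_mul_insert_of_commute hT hc
      have h2 := card_add_one_le_card_mul_union hc
      have h3 := two_mul_card_le_card_mul (T := T)
      omega

end RatAff

/-! ### Counting elements scale by scale. -/

namespace RatAff
open Finset

/-- The shifts of the elements of `X` of scale `v`. -/
def shifts (X : Finset RatAff) (v : ℚ) : Finset ℚ := (X.filter (fun x => x.scale = v)).image shift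

lemma mem_shifts {X : Finset RatAff} {v q : ℚ} :
    q ∈ shifts X v ↔ ∃ x ∈ X, x.scale = v ∧ x.shift = q := by
  simp [shifts, and_assoc]

lemma mem_shifts_mul {S : Finset RatAff} {x y : RatAff} (hx : x ∈ S) (hy : y ∈ S) {v q : ℚ}
    (hv : x.scale * y.scale = v) (hq : x.shift + x.scale * y.shift = q) :
    q ∈ shifts (S * S) v :=
  mem_shifts.2 ⟨x * y, mul_mem_mul hx hy, hv, hq⟩

/-- Elements of different scales are different, so lower bounds obtained at distinct scales add up.
-/
lemma sum_card_shifts_le (X : Finset RatAff) {L : List ℚ} (hL : L.Nodup) :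
    (L.map (fun v => #(shifts X v))).sum ≤ #X := by
  classical
  rw [← List.sum_toFinset _ hL]
  calc ∑ v ∈ L.toFinset, #(shifts X v)
      ≤ ∑ v ∈ L.toFinset, #(X.filter (fun x => x.scale = v)) :=
        sum_le_sum fun v _ => card_image_le
    _ = #(X.filter (fun x => x.scale ∈ L.toFinset)) := by
        rw [card_eq_sum_card_fiberwise (f := scale) (t := L.toFinset)]
        · refine sum_congr rfl fun v hv => ?_
          congr 1
          ext x
          simp only [mem_filter]
          constructor
          · rintro ⟨h1, rfl⟩; exact ⟨⟨h1, hv⟩, rfl⟩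
          · rintro ⟨⟨h1, -⟩, h2⟩; exact ⟨h1, h2⟩
        · intro x hx; exact (mem_filter.1 hx).2
    _ ≤ #X := card_le_card (filter_subset _ _)

lemma length_le_card {X : Finset ℚ} {l : List ℚ} (hl : l.Nodup) (h : ∀ x ∈ l, x ∈ X) :
    l.length ≤ #X := by
  classical
  rw [← List.toFinset_card_of_nodup hl]
  exact card_le_card fun x hx => h x (List.mem_toFinset.1 hx)

lemma length_le_card_of_lt {X : Finset ℚ} {l : List ℚ} (hl : l.IsChain (· < ·))
    (h : ∀ x ∈ l, x ∈ X) : l.length ≤ #X :=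
  length_le_card ((List.isChain_iff_pairwise.1 hl).imp fun h => h.ne) h

lemma three_le_card_add {X : Finset ℚ} {u₁ u₂ v₁ v₂ : ℚ} (hu : u₁ < u₂) (hv : v₁ < v₂)
    (h11 : u₁ + v₁ ∈ X) (h12 : u₁ + v₂ ∈ X) (h22 : u₂ + v₂ ∈ X) : 3 ≤ #X := by
  apply length_le_card_of_lt (l := [u₁ + v₁, u₁ + v₂, u₂ + v₂])
  · simp [hu, hv]
  · simp [*]

lemma four_le_card_add {X : Finset ℚ} {u₁ u₂ v₁ v₂ : ℚ} (hu : u₁ < u₂) (hv : v₁ < v₂)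
    (h : u₂ - u₁ ≠ v₂ - v₁) (h11 : u₁ + v₁ ∈ X) (h12 : u₁ + v₂ ∈ X) (h21 : u₂ + v₁ ∈ X)
    (h22 : u₂ + v₂ ∈ X) : 4 ≤ #X := by
  rcases lt_or_gt_of_ne h with h | h
  · apply length_le_card_of_lt (l := [u₁ + v₁, u₂ + v₁, u₁ + v₂, u₂ + v₂])
    · simp [hu]; linarith
    · simp [*]
  · apply length_le_card_of_lt (l := [u₁ + v₁, u₁ + v₂, u₂ + v₁, u₂ + v₂])
    · simp [hv]; linarith
    · simp [*]

/-- Two pairs of rationals with different gaps cover at least three points. -/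
lemma three_le_card_of_gap {X : Finset ℚ} {x₁ x₂ y₁ y₂ : ℚ} (hx : x₁ < x₂) (hy : y₁ < y₂)
    (h : x₂ - x₁ ≠ y₂ - y₁) (h1 : x₁ ∈ X) (h2 : x₂ ∈ X) (h3 : y₁ ∈ X) (h4 : y₂ ∈ X) :
    3 ≤ #X := by
  by_cases h31 : y₁ = x₁
  · have : y₂ ≠ x₂ := by rintro rfl; apply h; rw [h31]
    apply length_le_card (l := [x₁, x₂, y₂])
    · simp [hx.ne, this.symm]; rw [← h31]; exact hy.ne
    · simp [*]
  by_cases h32 : y₁ = x₂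
  · apply length_le_card_of_lt (l := [x₁, x₂, y₂])
    · simp [hx]; rw [← h32]; exact hy
    · simp [*]
  · apply length_le_card (l := [x₁, x₂, y₁])
    · simp [hx.ne, Ne.symm h31, Ne.symm h32]
    · simp [*]

/-! ### Weighted sums `α u i + β u j` on three and four points. -/

section weighted
variable {α β : ℚ}

/-- A zigzag through the index grid increases: raising the `α`-index adds `α` times a gap, and
moving one step from the `α`-index to the `β`-index adds `β - α` times a gap. -/
lemma seven_le_card_weighted (hα : 0 < α) (hαβ : α < β) {X : Finset ℚ} {u : Fin 3 → ℚ}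
    (h01 : u 0 < u 1) (h12 : u 1 < u 2) (h : ∀ i j, α * u i + β * u j ∈ X) : 7 ≤ #X := by
  have e1 := mul_pos hα (sub_pos.2 h01)
  have e2 := mul_pos hα (sub_pos.2 h12)
  have e3 := mul_pos (sub_pos.2 hαβ) (sub_pos.2 h01)
  have e4 := mul_pos (sub_pos.2 hαβ) (sub_pos.2 h12)
  apply length_le_card_of_lt (l := [α * u 0 + β * u 0, α * u 1 + β * u 0, α * u 0 + β * u 1,
    α * u 1 + β * u 1, α * u 2 + β * u 1, α * u 1 + β * u 2, α * u 2 + β * u 2])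
  · simp only [List.isChain_cons_cons, List.isChain_singleton, and_true]
    refine ⟨?_, ?_, ?_, ?_, ?_, ?_⟩ <;> linarith
  · simp [h]

lemma sq_ne_five (r : ℚ) : r ^ 2 ≠ 5 := by
  intro h
  have h5 : Irrational (Real.sqrt 5) := by
    have := (Nat.Prime.irrational_sqrt (p := 5) (by norm_num))
    exact_mod_cast this
  apply h5
  refine ⟨|r|, ?_⟩
  symm
  rw [Real.sqrt_eq_iff_mul_self_eq (by norm_num) (by positivity)]
  have : |r| * |r| = 5 := by rw [abs_mul_abs_self, ← h]; ring
  exact_mod_cast this.symm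

/-- A solution would make `b / a` a root of `r² + r = 1`, whose discriminant 5 is not a rational
square. -/
lemma mul_add_ne_sq {a b : ℚ} (ha : a ≠ 0) : b * b + a * b ≠ a * a := by
  intro h
  apply sq_ne_five (2 * (b / a) + 1)
  field_simp
  linear_combination 4 * h

/-- The relations forced on two consecutive gaps `a`, `b`. -/
lemma gap_relations (hα : 0 < α) (hαβ : α < β) {a b : ℚ} (ha : 0 < a) (hb : 0 < b)
    (h1 : α * (a + b) = β * a ∨ α * b = β * a) (h2 : β * b = α * a ∨ β * b = α * (a + b)) :
    β = 2 * α ∧ a = b := by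
  -- Of the four combinations, two give a golden-ratio equation between `a` and `b`, one contradicts
  -- `α < β`, and one is the stated solution.
  rcases h1 with h1 | h1 <;> rcases h2 with h2 | h2
  · exfalso
    apply mul_add_ne_sq (a := a) (b := b) ha.ne'
    have : α * (b * b + a * b) = α * (a * a) := by linear_combination b * h1 + a * h2
    exact mul_left_cancel₀ hα.ne' this
  · have hab : a = b := by
      have : β * a = β * b := by rw [h2, h1]
      exact mul_left_cancel₀ (hα.trans hαβ).ne' this
    subst hab
    refine ⟨?_, rfl⟩
    apply mul_right_cancel₀ ha.ne'
    linear_combination -h1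
  · exfalso
    have e1 := mul_pos (sub_pos.2 hαβ) ha
    have e2 := mul_pos (sub_pos.2 hαβ) hb
    linarith
  · exfalso
    apply mul_add_ne_sq (a := b) (b := a) hb.ne'
    have : α * (a * a + b * a) = α * (b * b) := by linear_combination -a * h2 - b * h1
    exact mul_left_cancel₀ hα.ne' this

/-- The zigzag already supplies ten sums, so under the bound every sum lies on it. The off-zigzag
sums with indices (2,0), (0,2), (3,1), (1,3) must then coincide with zigzag entries. Monotonicity
leaves two possibilities for each, which are the hypotheses of `gap_relations`. -/
lemma eq_of_card_weighted_le (hα : 0 < α) (hαβ : α < β) {X : Finset ℚ} {u : Fin 4 → ℚ}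
    (h01 : u 0 < u 1) (h12 : u 1 < u 2) (h23 : u 2 < u 3) (h : ∀ i j, α * u i + β * u j ∈ X)
    (hX : #X ≤ 10) : β = 2 * α ∧ u 1 - u 0 = u 2 - u 1 ∧ u 2 - u 1 = u 3 - u 2 := by
  have e1 := mul_pos hα (sub_pos.2 h01)
  have e2 := mul_pos hα (sub_pos.2 h12)
  have e3 := mul_pos hα (sub_pos.2 h23)
  have f1 := mul_pos (sub_pos.2 hαβ) (sub_pos.2 h01)
  have f2 := mul_pos (sub_pos.2 hαβ) (sub_pos.2 h12)
  have f3 := mul_pos (sub_pos.2 hαβ) (sub_pos.2 h23)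
  set l : List ℚ := [α * u 0 + β * u 0, α * u 1 + β * u 0, α * u 0 + β * u 1,
    α * u 1 + β * u 1, α * u 2 + β * u 1, α * u 1 + β * u 2, α * u 2 + β * u 2,
    α * u 3 + β * u 2, α * u 2 + β * u 3, α * u 3 + β * u 3] with hl
  have hc : l.IsChain (· < ·) := by
    simp only [hl, List.isChain_cons_cons, List.isChain_singleton, and_true]
    refine ⟨?_, ?_, ?_, ?_, ?_, ?_, ?_, ?_, ?_⟩ <;> linarith
  have hn : l.Nodup := (List.isChain_iff_pairwise.1 hc).imp fun h => h.ne
  have hlX : l.toFinset = X := by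
    apply eq_of_subset_of_card_le
    · intro x hx
      rw [List.mem_toFinset] at hx
      simp only [hl, List.mem_cons, List.not_mem_nil, or_false] at hx
      rcases hx with rfl | rfl | rfl | rfl | rfl | rfl | rfl | rfl | rfl | rfl <;> exact h _ _
    · rw [List.toFinset_card_of_nodup hn]; exact hX
  have key : ∀ i j, α * u i + β * u j ∈ l := fun i j => by
    rw [← List.mem_toFinset, hlX]; exact h i j
  simp only [hl, List.mem_cons, List.not_mem_nil, or_false] at key
  have k1 : α * (u 2 - u 0) = β * (u 1 - u 0) ∨ α * (u 2 - u 1) = β * (u 1 - u 0) := by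
    rcases key 2 0 with h | h | h | h | h | h | h | h | h | h
    all_goals first | (exfalso; linarith) | (left; linarith) | (right; linarith)
  have k2 : β * (u 2 - u 1) = α * (u 1 - u 0) ∨ β * (u 2 - u 1) = α * (u 2 - u 0) := by
    rcases key 0 2 with h | h | h | h | h | h | h | h | h | h
    all_goals first | (exfalso; linarith) | (left; linarith) | (right; linarith)
  have k3 : α * (u 3 - u 1) = β * (u 2 - u 1) ∨ α * (u 3 - u 2) = β * (u 2 - u 1) := by
    rcases key 3 1 with h | h | h | h | h | h | h | h | h | h
    all_goals first | (exfalso; linarith) | (left; linarith) | (right; linarith)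
  have k4 : β * (u 3 - u 2) = α * (u 2 - u 1) ∨ β * (u 3 - u 2) = α * (u 3 - u 1) := by
    rcases key 1 3 with h | h | h | h | h | h | h | h | h | h
    all_goals first | (exfalso; linarith) | (left; linarith) | (right; linarith)
  obtain ⟨r1, r2⟩ := gap_relations hα hαβ (sub_pos.2 h01) (sub_pos.2 h12)
    (by convert k1 using 2; ring_nf) (by convert k2 using 2; ring_nf)
  obtain ⟨-, r3⟩ := gap_relations hα hαβ (sub_pos.2 h12) (sub_pos.2 h23)
    (by convert k3 using 2; ring_nf) (by convert k4 using 2; ring_nf)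
  exact ⟨r1, r2, r3⟩

end weighted

end RatAff

/-! ### Extremal shapes, and four-element sets with a repeated scale. -/

namespace RatAff
open Finset

/-- `S` is a geometric progression `x, xc, xc², …` of elements of scale `2` or `1 / 2`,
with `c` a translation. -/
def IsProg (S : Finset RatAff) : Prop :=
  ∃ a d b : ℚ, 0 < d ∧ (b = 2 ∨ b = 1 / 2) ∧
    ∀ x, x ∈ S ↔ x.scale = b ∧ ∃ i : ℕ, i < #S ∧ x.shift = a + i * d

/-- `S` consists of `1, c, c²` for a translation `c` and an element of scale `2` or `1 / 2`. -/
def IsTri (S : Finset RatAff) : Prop :=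
  ∃ d b v : ℚ, d ≠ 0 ∧ (b = 2 ∨ b = 1 / 2) ∧
    ∀ x, x ∈ S ↔ x.scale = 1 ∧ (x.shift = 0 ∨ x.shift = d ∨ x.shift = 2 * d) ∨
      x.scale = b ∧ x.shift = v

section pairs
variable {S : Finset RatAff} {x₁ x₂ y : RatAff}

lemma three_le_shifts_pair (h1 : x₁ ∈ S) (h2 : x₂ ∈ S) (hs : x₁.scale = x₂.scale)
    (hlt : x₁.shift < x₂.shift) : 3 ≤ #(shifts (S * S) (x₁.scale * x₁.scale)) := by
  have ha := x₁.scale_pos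
  refine three_le_card_add hlt (mul_lt_mul_of_pos_left hlt ha) ?_ ?_ ?_
  · exact mem_shifts_mul h1 h1 rfl rfl
  · exact mem_shifts_mul h1 h2 (by rw [hs]) rfl
  · exact mem_shifts_mul h2 h2 (by rw [hs]) (by rw [hs])

/-- The products have shifts `xᵢ + s xⱼ`, with `s` the common scale: a sum of two pairs with gaps
`g` and `s g`, which differ when `s ≠ 1`. -/
lemma four_le_shifts_pair (h1 : x₁ ∈ S) (h2 : x₂ ∈ S) (hs : x₁.scale = x₂.scale)
    (hlt : x₁.shift < x₂.shift) (h : x₁.scale ≠ 1) :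
    4 ≤ #(shifts (S * S) (x₁.scale * x₁.scale)) := by
  have ha := x₁.scale_pos
  refine four_le_card_add hlt (mul_lt_mul_of_pos_left hlt ha) ?_ ?_ ?_ ?_ ?_
  · rw [← mul_sub]
    intro h'
    exact h (mul_right_cancel₀ (sub_pos.2 hlt).ne' (by linarith))
  · exact mem_shifts_mul h1 h1 rfl rfl
  · exact mem_shifts_mul h1 h2 (by rw [hs]) rfl
  · exact mem_shifts_mul h2 h1 (by rw [hs]) (by rw [hs])
  · exact mem_shifts_mul h2 h2 (by rw [hs]) (by rw [hs])

lemma two_le_shifts_pair_mul (h1 : x₁ ∈ S) (h2 : x₂ ∈ S) (hs : x₁.scale = x₂.scale)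
    (hlt : x₁.shift < x₂.shift) (hy : y ∈ S) :
    2 ≤ #(shifts (S * S) (x₁.scale * y.scale)) := by
  apply length_le_card_of_lt
    (l := [x₁.shift + x₁.scale * y.shift, x₂.shift + x₁.scale * y.shift])
  · simp [hlt]
  · simp only [List.mem_cons, List.not_mem_nil, or_false]
    rintro q (rfl | rfl)
    · exact mem_shifts_mul h1 hy rfl rfl
    · exact mem_shifts_mul h2 hy (by rw [hs]) (by rw [hs])

/-- The two products with `y` on the right have the gap of the pair; those with `y` on the left have
that gap times the scale of `y`. Two pairs with different gaps cannot coincide. -/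
lemma three_le_shifts_pair_mul (h1 : x₁ ∈ S) (h2 : x₂ ∈ S) (hs : x₁.scale = x₂.scale)
    (hlt : x₁.shift < x₂.shift) (hy : y ∈ S) (h : y.scale ≠ 1) :
    3 ≤ #(shifts (S * S) (x₁.scale * y.scale)) := by
  have hb := y.scale_pos
  refine three_le_card_of_gap (x₁ := x₁.shift + x₁.scale * y.shift)
    (x₂ := x₂.shift + x₁.scale * y.shift) (y₁ := y.shift + y.scale * x₁.shift)
    (y₂ := y.shift + y.scale * x₂.shift) (by linarith)
    (by have := mul_lt_mul_of_pos_left hlt hb; linarith) ?_ ?_ ?_ ?_ ?_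
  · intro h'
    exact h (mul_right_cancel₀ (sub_pos.2 hlt).ne' (by linarith))
  · exact mem_shifts_mul h1 hy rfl rfl
  · exact mem_shifts_mul h2 hy (by rw [hs]) (by rw [hs])
  · exact mem_shifts_mul hy h1 (mul_comm _ _) rfl
  · exact mem_shifts_mul hy h2 (by rw [hs, mul_comm]) rfl

lemma one_le_shifts {z : RatAff} (hy : y ∈ S) (hz : z ∈ S) :
    1 ≤ #(shifts (S * S) (y.scale * z.scale)) :=
  card_pos.2 ⟨_, mem_shifts_mul hy hz rfl rfl⟩

/-- The count is 3 + 3 + 3 if the pair has scale 1. Otherwise it is 4 + 3 + 2, as at most one of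
`y`, `z` has scale 1. -/
lemma nine_le_shifts_pair {z : RatAff} (h1 : x₁ ∈ S) (h2 : x₂ ∈ S) (hs : x₁.scale = x₂.scale)
    (hlt : x₁.shift < x₂.shift) (hy : y ∈ S) (hz : z ∈ S) (hxy : x₁.scale ≠ y.scale)
    (hxz : x₁.scale ≠ z.scale) (hyz : y.scale ≠ z.scale) :
    9 ≤ #(shifts (S * S) (x₁.scale * x₁.scale)) + #(shifts (S * S) (x₁.scale * y.scale)) +
      #(shifts (S * S) (x₁.scale * z.scale)) := by
  by_cases hx1 : x₁.scale = 1
  · have e1 := three_le_shifts_pair h1 h2 hs hlt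
    have e2 := three_le_shifts_pair_mul h1 h2 hs hlt hy (by rw [← hx1]; exact hxy.symm)
    have e3 := three_le_shifts_pair_mul h1 h2 hs hlt hz (by rw [← hx1]; exact hxz.symm)
    omega
  have e1 := four_le_shifts_pair h1 h2 hs hlt hx1
  by_cases hy1 : y.scale = 1
  · have e2 := two_le_shifts_pair_mul h1 h2 hs hlt hy
    have e3 := three_le_shifts_pair_mul h1 h2 hs hlt hz (by rw [← hy1]; exact hyz.symm)
    omega
  · have e2 := three_le_shifts_pair_mul h1 h2 hs hlt hy hy1
    have e3 := two_le_shifts_pair_mul h1 h2 hs hlt hz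
    omega

/-- The square of `y` is left out, since its scale may equal that of `x₁ z`; the five scales used
are strictly monotone. -/
lemma eleven_le_of_extreme_pair {z : RatAff} (h1 : x₁ ∈ S) (h2 : x₂ ∈ S)
    (hs : x₁.scale = x₂.scale) (hlt : x₁.shift < x₂.shift) (hy : y ∈ S) (hz : z ∈ S)
    (h : x₁.scale < y.scale ∧ y.scale < z.scale ∨ z.scale < y.scale ∧ y.scale < x₁.scale) :
    11 ≤ #(S * S) := by
  have hx := x₁.scale_pos
  have hy0 := y.scale_pos
  have hz0 := z.scale_pos
  have hL : [x₁.scale * x₁.scale, x₁.scale * y.scale, x₁.scale * z.scale, y.scale * z.scale,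
      z.scale * z.scale].Nodup := by
    rcases h with ⟨h, h'⟩ | ⟨h, h'⟩
    · refine List.Pairwise.imp (R := (· < ·)) (fun h => h.ne) (List.isChain_iff_pairwise.1 ?_)
      simp only [List.isChain_cons_cons, List.isChain_singleton, and_true]
      refine ⟨?_, ?_, ?_, ?_⟩ <;> gcongr
    · refine List.Pairwise.imp (R := (· > ·)) (fun h => h.ne') (List.isChain_iff_pairwise.1 ?_)
      simp only [List.isChain_cons_cons, List.isChain_singleton, and_true, gt_iff_lt]
      refine ⟨?_, ?_, ?_, ?_⟩ <;> gcongr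
  have e := sum_card_shifts_le (S * S) hL
  simp only [List.map_cons, List.map_nil, List.sum_cons, List.sum_nil] at e
  have e1 := nine_le_shifts_pair h1 h2 hs hlt hy hz (by rcases h with h | h <;> linarith [h.1, h.2])
    (by rintro h'; rcases h with h | h <;> linarith [h.1, h.2])
    (by rintro h'; rcases h with h | h <;> linarith [h.1, h.2])
  have e2 := one_le_shifts hy hz
  have e3 := one_le_shifts hz hz
  omega

/-- Here `y z` is left out, since its scale may equal that of the square of `x₁`. -/
lemma eleven_le_of_middle_pair {z : RatAff} (h1 : x₁ ∈ S) (h2 : x₂ ∈ S)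
    (hs : x₁.scale = x₂.scale) (hlt : x₁.shift < x₂.shift) (hy : y ∈ S) (hz : z ∈ S)
    (h : y.scale < x₁.scale) (h' : x₁.scale < z.scale) :
    11 ≤ #(S * S) := by
  have hx := x₁.scale_pos
  have hy0 := y.scale_pos
  have hz0 := z.scale_pos
  have hL : [y.scale * y.scale, x₁.scale * y.scale, x₁.scale * x₁.scale, x₁.scale * z.scale,
      z.scale * z.scale].Nodup := by
    refine List.Pairwise.imp (R := (· < ·)) (fun h => h.ne) (List.isChain_iff_pairwise.1 ?_)
    simp only [List.isChain_cons_cons, List.isChain_singleton, and_true]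
    refine ⟨?_, ?_, ?_, ?_⟩ <;> gcongr
  have e := sum_card_shifts_le (S * S) hL
  simp only [List.map_cons, List.map_nil, List.sum_cons, List.sum_nil] at e
  have e1 := nine_le_shifts_pair h1 h2 hs hlt hy hz h.ne' h'.ne (h.trans h').ne
  have e2 := one_le_shifts hy hy
  have e3 := one_le_shifts hz hz
  omega

/-- If neither scale is 1, the count is 4 + 3 + 4. If one is 1, a square contributes only 3, and the
mixed products must give 4: one order of multiplication does so when the gaps of the pairs differ,
the other when they agree. -/
lemma eleven_le_of_two_pairs {y₁ y₂ : RatAff} (h1 : x₁ ∈ S) (h2 : x₂ ∈ S)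
    (hs : x₁.scale = x₂.scale) (hlt : x₁.shift < x₂.shift) (hy1 : y₁ ∈ S) (hy2 : y₂ ∈ S)
    (hys : y₁.scale = y₂.scale) (hylt : y₁.shift < y₂.shift) (h : x₁.scale < y₁.scale) :
    11 ≤ #(S * S) := by
  have hx := x₁.scale_pos
  have hy0 := y₁.scale_pos
  have hL : [x₁.scale * x₁.scale, x₁.scale * y₁.scale, y₁.scale * y₁.scale].Nodup := by
    refine List.Pairwise.imp (R := (· < ·)) (fun h => h.ne) (List.isChain_iff_pairwise.1 ?_)
    simp only [List.isChain_cons_cons, List.isChain_singleton, and_true]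
    refine ⟨?_, ?_⟩ <;> gcongr
  have e := sum_card_shifts_le (S * S) hL
  simp only [List.map_cons, List.map_nil, List.sum_cons, List.sum_nil] at e
  have m1 : ∀ {x y : RatAff}, x ∈ S → y ∈ S → x.scale = x₁.scale → y.scale = y₁.scale →
      x.shift + x₁.scale * y.shift ∈ shifts (S * S) (x₁.scale * y₁.scale) := by
    intro x y hx hy hx' hy'
    exact mem_shifts_mul hx hy (by rw [hx', hy']) (by rw [hx'])
  have m2 : ∀ {x y : RatAff}, x ∈ S → y ∈ S → x.scale = x₁.scale → y.scale = y₁.scale →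
      y₁.scale * x.shift + y.shift ∈ shifts (S * S) (x₁.scale * y₁.scale) := by
    intro x y hx hy hx' hy'
    exact mem_shifts_mul hy hx (by rw [hx', hy', mul_comm]) (by rw [hy', add_comm])
  by_cases hx1 : x₁.scale = 1
  · have e1 := three_le_shifts_pair h1 h2 hs hlt
    have e2 := four_le_shifts_pair hy1 hy2 hys hylt (by rw [← hx1]; exact h.ne')
    have e3 : 4 ≤ #(shifts (S * S) (x₁.scale * y₁.scale)) := by
      by_cases hg : x₂.shift - x₁.shift = y₂.shift - y₁.shift
      · refine four_le_card_add (mul_lt_mul_of_pos_left hlt hy0) hylt ?_ (m2 h1 hy1 rfl rfl)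
          (m2 h1 hy2 rfl hys.symm) (m2 h2 hy1 hs.symm rfl) (m2 h2 hy2 hs.symm hys.symm)
        rw [← hg]
        intro h'
        have : y₁.scale = 1 := mul_right_cancel₀ (sub_pos.2 hlt).ne' (by linarith)
        linarith
      · refine four_le_card_add hlt (mul_lt_mul_of_pos_left hylt hx) ?_ (m1 h1 hy1 rfl rfl)
          (m1 h1 hy2 rfl hys.symm) (m1 h2 hy1 hs.symm rfl) (m1 h2 hy2 hs.symm hys.symm)
        rw [hx1, one_mul, one_mul]; exact hg
    omega
  have e1 := four_le_shifts_pair h1 h2 hs hlt hx1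
  by_cases hy1' : y₁.scale = 1
  · have e2 := three_le_shifts_pair hy1 hy2 hys hylt
    have e3 : 4 ≤ #(shifts (S * S) (x₁.scale * y₁.scale)) := by
      by_cases hg : x₂.shift - x₁.shift = y₂.shift - y₁.shift
      · refine four_le_card_add hlt (mul_lt_mul_of_pos_left hylt hx) ?_ (m1 h1 hy1 rfl rfl)
          (m1 h1 hy2 rfl hys.symm) (m1 h2 hy1 hs.symm rfl) (m1 h2 hy2 hs.symm hys.symm)
        rw [hg]
        intro h'
        exact hx1 (mul_right_cancel₀ (sub_pos.2 hylt).ne' (by linarith))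
      · refine four_le_card_add (mul_lt_mul_of_pos_left hlt hy0) hylt ?_ (m2 h1 hy1 rfl rfl)
          (m2 h1 hy2 rfl hys.symm) (m2 h2 hy1 hs.symm rfl) (m2 h2 hy2 hs.symm hys.symm)
        rw [hy1', one_mul, one_mul]; exact hg
    omega
  · have e2 := four_le_shifts_pair hy1 hy2 hys hylt hy1'
    have e3 := three_le_shifts_pair_mul h1 h2 hs hlt hy1 hy1'
    omega

end pairs

/-! ### A three-point set together with its dilate. -/

/-- A dilation with `b ≠ 1` moves one of the end points, so one of the two triples has an end point
beyond the other triple. -/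
lemma four_le_card_dilate {X : Finset ℚ} {b u₁ u₂ u₃ : ℚ} (hb : 0 < b) (hb1 : b ≠ 1)
    (h12 : u₁ < u₂) (h23 : u₂ < u₃) (m1 : u₁ ∈ X) (m2 : u₂ ∈ X) (m3 : u₃ ∈ X)
    (n1 : b * u₁ ∈ X) (n2 : b * u₂ ∈ X) (n3 : b * u₃ ∈ X) : 4 ≤ #X := by
  have g12 := mul_lt_mul_of_pos_left h12 hb
  have g23 := mul_lt_mul_of_pos_left h23 hb
  by_cases c1 : u₃ < b * u₃
  · apply length_le_card_of_lt (l := [u₁, u₂, u₃, b * u₃]) <;> simp [*]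
  by_cases c2 : b * u₁ < u₁
  · apply length_le_card_of_lt (l := [b * u₁, u₁, u₂, u₃]) <;> simp [*]
  by_cases c3 : b * u₃ < u₃
  · apply length_le_card_of_lt (l := [b * u₁, b * u₂, b * u₃, u₃]) <;> simp [*]
  by_cases c4 : u₁ < b * u₁
  · apply length_le_card_of_lt (l := [u₁, b * u₁, b * u₂, b * u₃]) <;> simp [*]
  · exfalso
    exact hb1 (mul_right_cancel₀ (sub_pos.2 (h12.trans h23)).ne' (by linarith))

/-- Two of the three dilated points return to the progression. Comparing their difference, `b d` or
`2 b d`, with the differences `d` and `2 d` determines `b`; either relation then places 0 at an end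
of the progression. -/
lemma eq_of_dilate_relations {b e d : ℚ} (hb : 0 < b) (hb1 : b ≠ 1) (hd : 0 < d)
    (h : ((b * (e - d) = e - d ∨ b * (e - d) = e ∨ b * (e - d) = e + d) ∧
      (b * e = e - d ∨ b * e = e ∨ b * e = e + d)) ∨
      ((b * e = e - d ∨ b * e = e ∨ b * e = e + d) ∧
      (b * (e + d) = e - d ∨ b * (e + d) = e ∨ b * (e + d) = e + d)) ∨
      ((b * (e - d) = e - d ∨ b * (e - d) = e ∨ b * (e - d) = e + d) ∧
      (b * (e + d) = e - d ∨ b * (e + d) = e ∨ b * (e + d) = e + d))) :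
    (b = 2 ∨ b = 1 / 2) ∧ (e = d ∨ e = -d) := by
  have hbd := mul_pos hb hd
  have one : b * d ≠ d := fun h => hb1 (mul_right_cancel₀ hd.ne' (by rw [h, one_mul]))
  have hb2 : b * d = 2 * d → b = 2 := fun h => mul_right_cancel₀ hd.ne' h
  have hb3 : b * d = d / 2 → b = 1 / 2 :=
    fun h => mul_right_cancel₀ hd.ne' (by rw [h]; ring)
  simp only [mul_sub, mul_add] at h
  generalize b * d = D at *
  generalize hE : b * e = E at *
  rcases h with ⟨h, h'⟩ | ⟨h, h'⟩ | ⟨h, h'⟩ <;> rcases h with h | h | h <;>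
    rcases h' with h' | h' | h'
  all_goals first
    | (exfalso; linarith)
    | (exfalso; exact one (by linarith))
    | (have hb' := hb2 (by linarith)
       refine ⟨Or.inl hb', ?_⟩
       rw [hb'] at hE
       first | (left; linarith) | (right; linarith))
    | (have hb' := hb3 (by linarith)
       refine ⟨Or.inr hb', ?_⟩
       rw [hb'] at hE
       first | (left; linarith) | (right; linarith))

lemma eq_of_card_dilate_le {X : Finset ℚ} {b e d : ℚ} (hb : 0 < b) (hb1 : b ≠ 1)
    (hd : 0 < d) (m1 : e - d ∈ X) (m2 : e ∈ X) (m3 : e + d ∈ X)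
    (n1 : b * (e - d) ∈ X) (n2 : b * e ∈ X) (n3 : b * (e + d) ∈ X) (hX : #X ≤ 4) :
    (b = 2 ∨ b = 1 / 2) ∧ (e = d ∨ e = -d) := by
  -- With at most four points in `X`, at most one lies outside the progression, so two of the three
  -- dilated points lie in it.
  have key : ∀ y z, y ∈ X → z ∈ X → y ≠ z →
      (y = e - d ∨ y = e ∨ y = e + d) ∨ (z = e - d ∨ z = e ∨ z = e + d) := by
    intro y z hy hz hyz
    by_contra! h
    obtain ⟨⟨h1, h2, h3⟩, h4, h5, h6⟩ := h
    have : 5 ≤ #X := by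
      apply length_le_card (l := [e - d, e, e + d, y, z])
      · simp only [List.nodup_cons, List.mem_cons, List.not_mem_nil, or_false, not_or,
          List.nodup_nil, and_true, not_false_eq_true]
        exact ⟨⟨by linarith, by linarith, h1.symm, h4.symm⟩, ⟨by linarith, h2.symm, h5.symm⟩,
          ⟨h3.symm, h6.symm⟩, hyz⟩
      · simp only [List.mem_cons, List.not_mem_nil, or_false]
        rintro x (rfl | rfl | rfl | rfl | rfl) <;> assumption
    omega
  have hbd := mul_pos hb hd
  have k1 := key _ _ n1 n2 (by intro h; linarith)
  have k2 := key _ _ n2 n3 (by intro h; linarith)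
  have k3 := key _ _ n1 n3 (by intro h; linarith)
  have gen : ∀ P Q R : Prop, P ∨ Q → Q ∨ R → P ∨ R → P ∧ Q ∨ Q ∧ R ∨ P ∧ R := by
    intro P Q R h1 h2 h3
    by_cases hP : P <;> by_cases hQ : Q <;> simp_all
  exact eq_of_dilate_relations hb hb1 hd (gen _ _ _ k1 k2 k3)

end RatAff

/-! ### Four-element sets with three or four equal scales. -/

namespace RatAff
open Finset

lemma and_or_three (A P Q R C : Prop) :
    A ∧ P ∨ A ∧ Q ∨ A ∧ R ∨ C ↔ A ∧ (P ∨ Q ∨ R) ∨ C := by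
  tauto

lemma and_or_three_reverse (A P Q R C : Prop) :
    A ∧ P ∨ A ∧ Q ∨ A ∧ R ∨ C ↔ A ∧ (R ∨ Q ∨ P) ∨ C := by
  tauto

/-- For a triple of scale 1 the minimum count is 5 + 4 + 1. Equality in the first term makes the
shifts an arithmetic progression; equality in the second brings in `eq_of_card_dilate_le`. For any
other scale the count is at least 7 + 3 + 1. -/
lemma isTri_of_triple {S : Finset RatAff} {t₁ t₂ t₃ s : RatAff}
    (hS : ∀ x, x ∈ S ↔ x = t₁ ∨ x = t₂ ∨ x = t₃ ∨ x = s)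
    (h12 : t₁.scale = t₂.scale) (h23 : t₂.scale = t₃.scale)
    (l12 : t₁.shift < t₂.shift) (l23 : t₂.shift < t₃.shift) (hs : t₁.scale ≠ s.scale)
    (hcard : #(S * S) ≤ 10) : IsTri S := by
  have m1 : t₁ ∈ S := (hS _).2 (by simp)
  have m2 : t₂ ∈ S := (hS _).2 (by simp)
  have m3 : t₃ ∈ S := (hS _).2 (by simp)
  have ms : s ∈ S := (hS _).2 (by simp)
  have ha := t₁.scale_pos
  have hb := s.scale_pos
  have hL : [t₁.scale * t₁.scale, t₁.scale * s.scale, s.scale * s.scale].Nodup := by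
    rcases lt_or_gt_of_ne hs with h | h
    · refine List.Pairwise.imp (R := (· < ·)) (fun h => h.ne) (List.isChain_iff_pairwise.1 ?_)
      simp only [List.isChain_cons_cons, List.isChain_singleton, and_true]
      refine ⟨?_, ?_⟩ <;> gcongr
    · refine List.Pairwise.imp (R := (· > ·)) (fun h => h.ne') (List.isChain_iff_pairwise.1 ?_)
      simp only [List.isChain_cons_cons, List.isChain_singleton, and_true, gt_iff_lt]
      refine ⟨?_, ?_⟩ <;> gcongr
  have e := sum_card_shifts_le (S * S) hL
  simp only [List.map_cons, List.map_nil, List.sum_cons, List.sum_nil] at e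
  have e3 := one_le_shifts ms ms
  have mul_mem : ∀ i j : Fin 3, (![t₁, t₂, t₃] i).shift + t₁.scale * (![t₁, t₂, t₃] j).shift ∈
      shifts (S * S) (t₁.scale * t₁.scale) := by
    have hm : ∀ i : Fin 3, ![t₁, t₂, t₃] i ∈ S ∧ (![t₁, t₂, t₃] i).scale = t₁.scale := by
      intro i
      fin_cases i
      · exact ⟨m1, rfl⟩
      · exact ⟨m2, h12.symm⟩
      · exact ⟨m3, (h12.trans h23).symm⟩
    intro i j
    exact mem_shifts_mul (hm i).1 (hm j).1 (by rw [(hm i).2, (hm j).2]) (by rw [(hm i).2])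
  have left : ∀ t ∈ S, t.scale = t₁.scale → t.shift + t₁.scale * s.shift ∈
      shifts (S * S) (t₁.scale * s.scale) := fun t ht h =>
    mem_shifts_mul ht ms (by rw [h]) (by rw [h])
  have right : ∀ t ∈ S, t.scale = t₁.scale → s.shift + s.scale * t.shift ∈
      shifts (S * S) (t₁.scale * s.scale) := fun t ht h =>
    mem_shifts_mul ms ht (by rw [h, mul_comm]) rfl
  by_cases ha1 : t₁.scale = 1
  · have hb1 : s.scale ≠ 1 := by rw [← ha1]; exact hs.symm
    -- translate so that the products of scale `s.scale` become `uᵢ` and `s.scale * uᵢ`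
    set X := (shifts (S * S) (t₁.scale * s.scale)).image (fun q => q - s.shift) with hX
    have hXc : #X ≤ #(shifts (S * S) (t₁.scale * s.scale)) := card_image_le
    have left' : ∀ t ∈ S, t.scale = t₁.scale → t.shift ∈ X := fun t ht h =>
      mem_image.2 ⟨_, left t ht h, by rw [ha1]; ring⟩
    have right' : ∀ t ∈ S, t.scale = t₁.scale → s.scale * t.shift ∈ X := fun t ht h =>
      mem_image.2 ⟨_, right t ht h, by ring⟩
    have e2 := four_le_card_dilate hb hb1 l12 l23 (left' _ m1 rfl) (left' _ m2 h12.symm)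
      (left' _ m3 (h12.trans h23).symm) (right' _ m1 rfl) (right' _ m2 h12.symm)
      (right' _ m3 (h12.trans h23).symm)
    rw [ha1] at mul_mem
    simp only [one_mul] at mul_mem
    have e1 : 5 ≤ #(shifts (S * S) (t₁.scale * t₁.scale)) := by
      apply length_le_card_of_lt (l := [t₁.shift + t₁.shift, t₁.shift + t₂.shift,
        t₂.shift + t₂.shift, t₂.shift + t₃.shift, t₃.shift + t₃.shift])
      · simp [l12, l23]
      · rw [ha1, one_mul]
        simp only [List.mem_cons, List.not_mem_nil, or_false]
        rintro q (rfl | rfl | rfl | rfl | rfl)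
        exacts [mul_mem 0 0, mul_mem 0 1, mul_mem 1 1, mul_mem 1 2, mul_mem 2 2]
    have hmid : t₁.shift + t₃.shift = t₂.shift + t₂.shift := by
      by_contra hne
      have : 6 ≤ #(shifts (S * S) (t₁.scale * t₁.scale)) := by
        rcases lt_or_gt_of_ne hne with hne | hne
        · apply length_le_card_of_lt (l := [t₁.shift + t₁.shift, t₁.shift + t₂.shift,
            t₁.shift + t₃.shift, t₂.shift + t₂.shift, t₂.shift + t₃.shift, t₃.shift + t₃.shift])
          · simp [l12, l23, hne]
          · rw [ha1, one_mul]
            simp only [List.mem_cons, List.not_mem_nil, or_false]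
            rintro q (rfl | rfl | rfl | rfl | rfl | rfl)
            exacts [mul_mem 0 0, mul_mem 0 1, mul_mem 0 2, mul_mem 1 1, mul_mem 1 2, mul_mem 2 2]
        · apply length_le_card_of_lt (l := [t₁.shift + t₁.shift, t₁.shift + t₂.shift,
            t₂.shift + t₂.shift, t₁.shift + t₃.shift, t₂.shift + t₃.shift, t₃.shift + t₃.shift])
          · simp [l12, l23, hne]
          · rw [ha1, one_mul]
            simp only [List.mem_cons, List.not_mem_nil, or_false]
            rintro q (rfl | rfl | rfl | rfl | rfl | rfl)
            exacts [mul_mem 0 0, mul_mem 0 1, mul_mem 1 1, mul_mem 0 2, mul_mem 1 2, mul_mem 2 2]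
      omega
    obtain ⟨d, hd⟩ : ∃ d, d = t₂.shift - t₁.shift := ⟨_, rfl⟩
    obtain ⟨e, he⟩ : ∃ e, e = t₂.shift := ⟨_, rfl⟩
    have u1 : t₁.shift = e - d := by rw [he, hd]; ring
    have u3 : t₃.shift = e + d := by rw [he, hd]; linarith
    have fin := eq_of_card_dilate_le (X := X) (b := s.scale) (e := e) (d := d) hb hb1
      (by rw [hd]; linarith) (u1 ▸ left' _ m1 rfl) (he ▸ left' _ m2 h12.symm)
      (u3 ▸ left' _ m3 (h12.trans h23).symm) (u1 ▸ right' _ m1 rfl) (he ▸ right' _ m2 h12.symm)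
      (u3 ▸ right' _ m3 (h12.trans h23).symm) (by omega)
    have hd0 : d ≠ 0 := by rw [hd]; linarith
    -- The shifts are `0, d, 2d` or `-2d, -d, 0`; in the second case `c` has shift `-d`.
    obtain ⟨hb2, rfl | rfl⟩ := fin
    · refine ⟨e, s.scale, s.shift, hd0, hb2, fun x => ?_⟩
      rw [hS, RatAff.ext_iff, RatAff.ext_iff, RatAff.ext_iff, RatAff.ext_iff, ← h23, ← h12, ha1,
        u1, ← he, u3, sub_self, two_mul]
      exact and_or_three _ _ _ _ _
    · refine ⟨-d, s.scale, s.shift, neg_ne_zero.2 hd0, hb2, fun x => ?_⟩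
      rw [hS, RatAff.ext_iff, RatAff.ext_iff, RatAff.ext_iff, RatAff.ext_iff, ← h23, ← h12, ha1,
        u1, ← he, u3, neg_add_cancel, two_mul, ← sub_eq_add_neg]
      exact and_or_three_reverse _ _ _ _ _
  · exfalso
    have e1 : 7 ≤ #(shifts (S * S) (t₁.scale * t₁.scale)) := by
      rcases lt_or_gt_of_ne ha1 with h | h
      · refine seven_le_card_weighted (α := t₁.scale) (β := 1)
          (u := fun i => (![t₁, t₂, t₃] i).shift) ha h l12 l23 fun i j => ?_
        have := mul_mem j i
        rwa [one_mul, add_comm]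
      · refine seven_le_card_weighted (α := 1) (β := t₁.scale)
          (u := fun i => (![t₁, t₂, t₃] i).shift) one_pos h l12 l23 fun i j => ?_
        have := mul_mem i j
        rwa [one_mul]
    have e2 : 3 ≤ #(shifts (S * S) (t₁.scale * s.scale)) := by
      apply length_le_card_of_lt (l := [t₁.shift + t₁.scale * s.shift,
        t₂.shift + t₁.scale * s.shift, t₃.shift + t₁.scale * s.shift])
      · simp [l12, l23]
      · simp only [List.mem_cons, List.not_mem_nil, or_false]
        rintro q (rfl | rfl | rfl)
        exacts [left _ m1 rfl, left _ m2 h12.symm, left _ m3 (h12.trans h23).symm]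
    omega

/-- Noncommutativity excludes scale 1. The weights are `1` and the common scale, taken in increasing
order, so the ratio 2 of the weights gives scale 2 or 1/2. -/
lemma isProg_of_four {S : Finset RatAff} (hcard4 : #S = 4) (hn : Noncomm S) {t : Fin 4 → RatAff}
    (hS : ∀ x, x ∈ S ↔ ∃ i, x = t i) {a : ℚ} (ht : ∀ i, (t i).scale = a)
    (l01 : (t 0).shift < (t 1).shift) (l12 : (t 1).shift < (t 2).shift)
    (l23 : (t 2).shift < (t 3).shift) (hcard : #(S * S) ≤ 10) : IsProg S := by
  have hm : ∀ i, t i ∈ S := fun i => (hS _).2 ⟨i, rfl⟩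
  have ha : 0 < a := ht 0 ▸ (t 0).scale_pos
  have ha1 : a ≠ 1 := by
    rintro rfl
    obtain ⟨x, hx, y, hy, hxy⟩ := hn
    obtain ⟨i, rfl⟩ := (hS x).1 hx
    obtain ⟨j, rfl⟩ := (hS y).1 hy
    apply hxy
    rw [commute_iff, ht, ht]; simp
  have hX : #(shifts (S * S) (a * a)) ≤ 10 := by
    have := sum_card_shifts_le (S * S) (L := [a * a]) (by simp)
    simp at this
    omega
  have mul_mem : ∀ i j, (t i).shift + a * (t j).shift ∈ shifts (S * S) (a * a) := fun i j =>
    mem_shifts_mul (hm i) (hm j) (by rw [ht, ht]) (by rw [ht])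
  have key : (a = 2 ∨ a = 1 / 2) ∧ (t 1).shift - (t 0).shift = (t 2).shift - (t 1).shift ∧
      (t 2).shift - (t 1).shift = (t 3).shift - (t 2).shift := by
    rcases lt_or_gt_of_ne ha1 with h | h
    · have := eq_of_card_weighted_le (u := fun i => (t i).shift) ha h l01 l12 l23
        (fun i j => by rw [one_mul, add_comm]; exact mul_mem j i) hX
      exact ⟨Or.inr (by linarith [this.1]), this.2⟩
    · have := eq_of_card_weighted_le (u := fun i => (t i).shift) one_pos h l01 l12 l23
        (fun i j => by rw [one_mul]; exact mul_mem i j) hX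
      exact ⟨Or.inl (by linarith [this.1]), this.2⟩
  obtain ⟨h2, g1, g2⟩ := key
  refine ⟨(t 0).shift, (t 1).shift - (t 0).shift, a, sub_pos.2 l01, h2, fun x => ?_⟩
  have hshift : ∀ i : Fin 4, (t i).shift = (t 0).shift + (i : ℕ) * ((t 1).shift - (t 0).shift) := by
    intro i
    fin_cases i
    · simp
    · simp
    · simp only [Fin.reduceFinMk]; push_cast; linarith
    · simp only [Fin.reduceFinMk]; push_cast; linarith
  rw [hS, hcard4]
  constructor
  · rintro ⟨i, rfl⟩
    exact ⟨ht i, i, i.2, hshift i⟩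
  · rintro ⟨h1, i, hi, h3⟩
    exact ⟨⟨i, hi⟩, RatAff.ext (by rw [h1, ht]) (h3.trans (hshift ⟨i, hi⟩).symm)⟩

lemma two_le_shifts_of_not_commute {X : Finset RatAff} {x y : RatAff} (h : ¬ Commute x y)
    (hxy : x * y ∈ X) (hyx : y * x ∈ X) : 2 ≤ #(shifts X (x.scale * y.scale)) := by
  apply length_le_card (l := [(x * y).shift, (y * x).shift])
  · simp only [List.nodup_cons, List.mem_singleton, List.not_mem_nil, not_false_eq_true,
      List.nodup_nil, and_true]
    intro h'
    exact h (RatAff.ext (mul_comm _ _) h')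
  · simp only [List.mem_cons, List.not_mem_nil, or_false]
    rintro q (rfl | rfl)
    · exact mem_shifts.2 ⟨_, hxy, rfl, rfl⟩
    · exact mem_shifts.2 ⟨_, hyx, mul_comm _ _, rfl⟩

lemma card_add_four_le {α : Type*} [DecidableEq α] {X Y : Finset α} (h : Y ⊆ X) {a b c d : α}
    (ha : a ∈ X) (hb : b ∈ X) (hc : c ∈ X) (hd : d ∈ X) (ha' : a ∉ Y) (hb' : b ∉ Y) (hc' : c ∉ Y)
    (hd' : d ∉ Y) (hn : [a, b, c, d].Nodup) : #Y + 4 ≤ #X := by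
  simp only [List.nodup_cons, List.mem_cons, List.not_mem_nil, or_false, not_or,
    not_false_eq_true, List.nodup_nil, and_true] at hn
  obtain ⟨⟨hab, hac, had⟩, ⟨hbc, hbd⟩, hcd⟩ := hn
  have := card_add_three_le (X := X) (Y := insert d Y) (insert_subset hd h) ha hb hc
    (by simp [had, ha']) (by simp [hbd, hb']) (by simp [hcd, hc']) hab hac hbc
  rw [card_insert_of_notMem hd'] at this
  omega

end RatAff

/-! ### Four distinct scales, and the four-element classification. -/

namespace RatAff
open Finset

/-- At most one of `p, q, r` commutes with `s`: of two such elements one is nontrivial, and `s`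
would commute with all three. The mixed products thus number at least 2 + 2 + 1, besides five in `T
* T` and the square of `s`. -/
lemma eleven_le_of_commute_three {p q r s : RatAff} (hpq : p.scale < q.scale)
    (hqr : q.scale < r.scale) (hT : ∀ x ∈ ({p, q, r} : Finset RatAff), ∀ y ∈ ({p, q, r} :
    Finset RatAff), Commute x y) (hs : ∃ t ∈ ({p, q, r} : Finset RatAff), ¬ Commute s t) :
    11 ≤ #(insert s {p, q, r} * insert s {p, q, r} : Finset RatAff) := by
  have npq : p ≠ q := by rintro rfl; exact hpq.false
  have nqr : q ≠ r := by rintro rfl; exact hqr.false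
  have npr : p ≠ r := by rintro rfl; exact (hpq.trans hqr).false
  set T : Finset RatAff := {p, q, r} with hTdef
  have hT3 : #T = 3 := card_eq_three.2 ⟨p, q, r, npq, npr, nqr, rfl⟩
  have hp : p ∈ T := by simp [hTdef]
  have hq : q ∈ T := by simp [hTdef]
  have hr : r ∈ T := by simp [hTdef]
  have e1 := card_mul_insert_of_commute hT hs
  have e2 := two_mul_card_le_card_mul (T := T)
  have key : ∀ x ∈ T, ∀ y ∈ T, x ≠ y → ¬ Commute s x ∨ ¬ Commute s y := by
    intro x hx y hy hxy
    by_contra! h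
    obtain ⟨t, ht, hst⟩ := hs
    by_cases hx1 : x = 1
    · exact hst (commute_trans (fun hy1 => hxy (hx1.trans hy1.symm)) h.2.symm (hT y hy t ht))
    · exact hst (commute_trans hx1 h.1.symm (hT x hx t ht))
  have hs0 := s.scale_pos
  have hL : [s.scale * p.scale, s.scale * q.scale, s.scale * r.scale].Nodup := by
    refine List.Pairwise.imp (R := (· < ·)) (fun h => h.ne) (List.isChain_iff_pairwise.1 ?_)
    simp only [List.isChain_cons_cons, List.isChain_singleton, and_true]
    refine ⟨?_, ?_⟩ <;> gcongr
  have e := sum_card_shifts_le ({s} * T ∪ T * {s}) hL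
  simp only [List.map_cons, List.map_nil, List.sum_cons, List.sum_nil] at e
  have hl : ∀ {x}, x ∈ T → s * x ∈ {s} * T ∪ T * {s} := fun hx =>
    mem_union_left _ (mul_mem_mul (mem_singleton_self s) hx)
  have hr' : ∀ {x}, x ∈ T → x * s ∈ {s} * T ∪ T * {s} := fun hx =>
    mem_union_right _ (mul_mem_mul hx (mem_singleton_self s))
  have one : ∀ {x}, x ∈ T → 1 ≤ #(shifts ({s} * T ∪ T * {s}) (s.scale * x.scale)) := fun hx =>
    card_pos.2 ⟨_, mem_shifts.2 ⟨_, hl hx, rfl, rfl⟩⟩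
  have two : ∀ {x}, x ∈ T → ¬ Commute s x →
      2 ≤ #(shifts ({s} * T ∪ T * {s}) (s.scale * x.scale)) := fun hx h =>
    two_le_shifts_of_not_commute h (hl hx) (hr' hx)
  have op := one hp
  have oq := one hq
  have o_r := one hr
  have k1 := (key p hp q hq npq).imp (two hp) (two hq)
  have k2 := (key p hp r hr npr).imp (two hp) (two hr)
  have k3 := (key q hq r hr nqr).imp (two hq) (two hr)
  omega

lemma commute_mul_left_cancel {s x y : RatAff} (h : Commute s (x * y)) (hy : Commute s y) :
    Commute s x := by
  have : x = x * y * y⁻¹ := by group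
  rw [this]
  exact h.mul_right hy.inv_right

/-- As `T * T` has at least seven elements, at most three products are new. Those of the scales of
`s²` and `r s` are new, and one of the scale of `q s` is new unless it equals `r²`. If `s` and `r`
do not commute, `q s` and `s q` must both be `r²`, making `s` commute with `q`, then `r²`, then `r`.
If `s` commutes with `r` but not `q`, then `s²`, `s r`, `s q`, `q s` are four new products. -/
lemma commute_of_four_scales {p q r s : RatAff} (hpq : p.scale < q.scale)
    (hqr : q.scale < r.scale) (hrs : r.scale < s.scale)
    (hT : Noncomm {p, q, r})
    (hcard : #(insert s {p, q, r} * insert s {p, q, r} : Finset RatAff) ≤ 10) :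
    Commute s q ∧ Commute s r := by
  have npq : p ≠ q := by rintro rfl; exact hpq.false
  have nqr : q ≠ r := by rintro rfl; exact hqr.false
  have npr : p ≠ r := by rintro rfl; exact (hpq.trans hqr).false
  set T : Finset RatAff := {p, q, r} with hTdef
  have hT3 : #T = 3 := card_eq_three.2 ⟨p, q, r, npq, npr, nqr, rfl⟩
  have hq : q ∈ insert s T := by simp [hTdef]
  have hr : r ∈ insert s T := by simp [hTdef]
  have hs : s ∈ insert s T := mem_insert_self _ _
  have e7 := three_mul_card_le hT
  have hsub : T * T ⊆ insert s T * insert s T :=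
    mul_subset_mul (subset_insert _ _) (subset_insert _ _)
  have hp0 := p.scale_pos
  have hq0 := q.scale_pos
  have hr0 := r.scale_pos
  have hs0 := s.scale_pos
  have hTle : ∀ x ∈ T, x.scale ≤ r.scale ∧ (x = r ∨ x.scale ≤ q.scale) := by
    intro x hx
    simp only [hTdef, mem_insert, mem_singleton] at hx
    rcases hx with rfl | rfl | rfl
    · exact ⟨(hpq.trans hqr).le, Or.inr hpq.le⟩
    · exact ⟨hqr.le, Or.inr le_rfl⟩
    · exact ⟨le_rfl, Or.inl rfl⟩
  have hTT : ∀ z ∈ T * T, z = r * r ∨ z.scale ≤ q.scale * r.scale := by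
    intro z hz
    obtain ⟨a, ha, b, hb, rfl⟩ := mem_mul.1 hz
    have ha0 := a.scale_pos
    have hb0 := b.scale_pos
    obtain ⟨ha1, ha2 | ha2⟩ := hTle a ha
    · obtain ⟨hb1, hb2 | hb2⟩ := hTle b hb
      · left; rw [ha2, hb2]
      · right; rw [scale_mul, mul_comm q.scale]; gcongr
    · right; rw [scale_mul]; gcongr; exact (hTle b hb).1
  have hlarge : ∀ z, r.scale * r.scale < z.scale → z ∉ T * T := by
    intro z hz hzT
    rcases hTT z hzT with rfl | h
    · exact hz.false
    · have : q.scale * r.scale < r.scale * r.scale := by gcongr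
      linarith
  have hmid : ∀ z, z.scale = q.scale * s.scale → z ≠ r * r → z ∉ T * T := by
    intro z hz hne hzT
    rcases hTT z hzT with h | h
    · exact hne h
    · have : q.scale * r.scale < q.scale * s.scale := by gcongr
      linarith
  have nss : s * s ∉ T * T := hlarge _ (by simp only [scale_mul]; gcongr)
  have nsr : s * r ∉ T * T := hlarge _ (by simp only [scale_mul]; gcongr)
  have nrs : r * s ∉ T * T := hlarge _ (by simp only [scale_mul]; gcongr)
  have ne_of_scale : ∀ {x y : RatAff}, y.scale < x.scale → x ≠ y := by
    rintro x y h rfl; exact h.false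
  have l1 : q.scale * s.scale < r.scale * s.scale := by gcongr
  have l2 : r.scale * s.scale < s.scale * s.scale := by gcongr
  have crr : Commute s (r * r) → Commute s r := fun h => (commute_of_sq h.symm).symm
  have hsr : Commute s r := by
    by_contra hsr
    have extra : ∀ w ∈ insert s T * insert s T, w.scale = q.scale * s.scale → w = r * r := by
      intro w hw hws
      by_contra hne
      have := card_add_four_le hsub (mul_mem_mul hs hs) (mul_mem_mul hs hr) (mul_mem_mul hr hs) hw
        nss nsr nrs (hmid w hws hne) (by
          simp only [List.nodup_cons, List.mem_cons, List.not_mem_nil, or_false, not_or,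
            not_false_eq_true, List.nodup_nil, and_true]
          refine ⟨⟨?_, ?_, ?_⟩, ⟨hsr, ?_⟩, ?_⟩
          all_goals apply ne_of_scale; simp only [scale_mul]; linarith)
      omega
    have h1 := extra (q * s) (mul_mem_mul hq hs) rfl
    have h2 := extra (s * q) (mul_mem_mul hs hq) (mul_comm _ _)
    have hsq : Commute s q := h2.trans h1.symm
    exact hsr (crr (h2 ▸ (Commute.refl s).mul_right hsq))
  refine ⟨?_, hsr⟩
  by_contra hsq
  have hcc : Commute s (r * r) := hsr.mul_right hsr
  have h1 : q * s ≠ r * r := fun h =>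
    hsq (commute_mul_left_cancel (h ▸ hcc) (Commute.refl s))
  have h2 : s * q ≠ r * r := by
    intro h
    apply hsq
    have : q = s⁻¹ * (s * q) := by group
    rw [this, h]
    exact (Commute.refl s).inv_right.mul_right hcc
  have := card_add_four_le hsub (mul_mem_mul hs hs) (mul_mem_mul hs hr) (mul_mem_mul hs hq)
    (mul_mem_mul hq hs) nss nsr (hmid _ (mul_comm _ _) h2) (hmid _ rfl h1) (by
      simp only [List.nodup_cons, List.mem_cons, List.not_mem_nil, or_false, not_or,
        not_false_eq_true, List.nodup_nil, and_true]
      refine ⟨⟨?_, ?_, ?_⟩, ⟨?_, ?_⟩, hsq⟩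
      all_goals apply ne_of_scale; simp only [scale_mul]; linarith)
  omega

lemma card_inv_mul_inv (S : Finset RatAff) : #(S⁻¹ * S⁻¹) = #(S * S) := by
  rw [← mul_inv_rev, card_inv]

lemma eleven_le_of_four_scales {S : Finset RatAff} (hn : Noncomm S) {p q r s : RatAff}
    (hS : ∀ x, x ∈ S ↔ x = p ∨ x = q ∨ x = r ∨ x = s) (hpq : p.scale < q.scale)
    (hqr : q.scale < r.scale) (hrs : r.scale < s.scale) : 11 ≤ #(S * S) := by
  have hS1 : S = insert s {p, q, r} := by
    ext x; rw [hS]; simp only [mem_insert, mem_singleton]; tauto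
  have hS2 : S = insert p {q, r, s} := by
    ext x; rw [hS]; simp only [mem_insert, mem_singleton]
  by_cases h1 : Noncomm {p, q, r}
  swap
  · rw [not_noncomm] at h1
    have := eleven_le_of_commute_three hpq hqr h1 (exists_not_commute_of_insert (hS1 ▸ hn) h1)
    rwa [← hS1] at this
  by_cases h2 : Noncomm {q, r, s}
  swap
  · rw [not_noncomm] at h2
    have := eleven_le_of_commute_three hqr hrs h2 (exists_not_commute_of_insert (hS2 ▸ hn) h2)
    rwa [← hS2] at this
  by_contra! hcard
  obtain ⟨c1, c2⟩ := commute_of_four_scales hpq hqr hrs h1 (by rw [← hS1]; omega)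
  have inv_lt : ∀ {x y : RatAff}, x.scale < y.scale → y⁻¹.scale < x⁻¹.scale := by
    intro x y h
    have := x.scale_pos
    simp only [scale_inv]
    gcongr
  have hSi : S⁻¹ = insert p⁻¹ {s⁻¹, r⁻¹, q⁻¹} := by
    ext x; rw [mem_inv', hS]
    simp only [mem_insert, mem_singleton, inv_eq_iff_eq_inv]; tauto
  have h2' : Noncomm {s⁻¹, r⁻¹, q⁻¹} := by
    obtain ⟨x, hx, y, hy, hxy⟩ := h2
    refine ⟨x⁻¹, ?_, y⁻¹, ?_, fun h => hxy (by simpa using h.inv_inv)⟩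
    · simp only [mem_insert, mem_singleton, inv_inj] at hx ⊢; tauto
    · simp only [mem_insert, mem_singleton, inv_inj] at hy ⊢; tauto
  obtain ⟨c3, c4⟩ := commute_of_four_scales (inv_lt hrs) (inv_lt hqr) (inv_lt hpq) h2'
    (by rw [← hSi, card_inv_mul_inv]; omega)
  have c3' : Commute p r := by simpa using c3.inv_inv
  have c4' : Commute p q := by simpa using c4.inv_inv
  -- Both `p` and `s` commute with `q` and `r`. Since `q` and `r` do not commute, `p` and `s` are
  -- both 1, against the order of the scales.
  have nqr : ¬ Commute q r := by
    intro h
    obtain ⟨x, hx, y, hy, hxy⟩ := h1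
    simp only [mem_insert, mem_singleton] at hx hy
    rcases hx with rfl | rfl | rfl <;> rcases hy with rfl | rfl | rfl
    all_goals first
      | exact hxy (Commute.refl _)
      | exact hxy ‹_›
      | exact hxy (Commute.symm ‹_›)
  have hp1 : p = 1 := by
    by_contra h
    exact nqr (commute_trans h c4' c3')
  have hs1 : s = 1 := by
    by_contra h
    exact nqr (commute_trans h c1 c2)
  have := hpq.trans (hqr.trans hrs)
  rw [hp1, hs1] at this
  exact this.false

lemma exists_strictMono_four {S : Finset RatAff} (h : #S = 4) : ∃ t : Fin 4 → RatAff,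
    StrictMono t ∧ ∀ x, x ∈ S ↔ ∃ i, x = t i := by
  refine ⟨S.orderEmbOfFin h, (S.orderEmbOfFin h).strictMono, fun x => ?_⟩
  rw [← mem_coe, ← S.range_orderEmbOfFin h, Set.mem_range]
  exact exists_congr fun i => eq_comm

theorem isProg_or_isTri_of_card_four {S : Finset RatAff} (h4 : #S = 4) (hn : Noncomm S)
    (hcard : #(S * S) ≤ 10) : IsProg S ∨ IsTri S := by
  obtain ⟨t, ht, hS⟩ := exists_strictMono_four h4
  have hS' : ∀ x, x ∈ S ↔ x = t 0 ∨ x = t 1 ∨ x = t 2 ∨ x = t 3 := by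
    intro x; rw [hS, Fin.exists_fin_succ, Fin.exists_fin_succ, Fin.exists_fin_succ,
      Fin.exists_fin_one]; rfl
  have m : ∀ i, t i ∈ S := fun i => (hS _).2 ⟨i, rfl⟩
  have h01 : t 0 < t 1 := ht (by decide)
  have h12 : t 1 < t 2 := ht (by decide)
  have h23 : t 2 < t 3 := ht (by decide)
  rw [lt_iff] at h01 h12 h23
  have contra : 11 ≤ #(S * S) → IsProg S ∨ IsTri S := fun h => by omega
  rcases h01 with h01 | ⟨h01, l01⟩ <;> rcases h12 with h12 | ⟨h12, l12⟩ <;>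
    rcases h23 with h23 | ⟨h23, l23⟩
  · exact contra (eleven_le_of_four_scales hn hS' h01 h12 h23)
  · exact contra (eleven_le_of_extreme_pair (m 2) (m 3) h23 l23 (m 1) (m 0) (Or.inr ⟨h01, h12⟩))
  · exact contra (eleven_le_of_middle_pair (m 1) (m 2) h12 l12 (m 0) (m 3) h01 (h12 ▸ h23))
  · right
    refine isTri_of_triple (t₁ := t 1) (t₂ := t 2) (t₃ := t 3) (s := t 0) (fun x => ?_) h12 h23
      l12 l23 h01.ne' hcard
    rw [hS']; tauto
  · exact contra (eleven_le_of_extreme_pair (m 0) (m 1) h01 l01 (m 2) (m 3)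
      (Or.inl ⟨h01 ▸ h12, h23⟩))
  · exact contra (eleven_le_of_two_pairs (m 0) (m 1) h01 l01 (m 2) (m 3) h23 l23 (h01 ▸ h12))
  · right
    exact isTri_of_triple hS' h01 h12 l01 l12 (by rw [h01, h12]; exact h23.ne) hcard
  · left
    refine isProg_of_four h4 hn hS (a := (t 0).scale) (fun i => ?_) l01 l12 l23 hcard
    fin_cases i
    · rfl
    · exact h01.symm
    · exact (h01.trans h12).symm
    · exact (h01.trans (h12.trans h23)).symm

end RatAff

/-! ### Induction step: deleting an extreme element. -/

namespace RatAff
open Finset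

lemma Noncomm.inv {S : Finset RatAff} (h : Noncomm S) : Noncomm S⁻¹ := by
  obtain ⟨x, hx, y, hy, hxy⟩ := h
  exact ⟨x⁻¹, inv_mem_inv hx, y⁻¹, inv_mem_inv hy, fun h => hxy (by simpa using h.inv_inv)⟩

lemma IsTri.inv {S : Finset RatAff} (h : IsTri S) : IsTri S⁻¹ := by
  obtain ⟨d, b, v, hd, hb, h⟩ := h
  have hb0 : b ≠ 0 := by rcases hb with rfl | rfl <;> norm_num
  refine ⟨-d, b⁻¹, -(b⁻¹ * v), neg_ne_zero.2 hd, ?_, fun x => ?_⟩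
  · rcases hb with rfl | rfl
    · right; norm_num
    · left; norm_num
  · have hx := x.scale_ne_zero
    rw [mem_inv', h, scale_inv, shift_inv]
    apply or_congr
    · rw [inv_eq_one]
      refine and_congr_right fun h1 => ?_
      rw [h1, inv_one, one_mul, neg_eq_zero, neg_eq_iff_eq_neg, neg_eq_iff_eq_neg, mul_neg]
    · rw [inv_eq_iff_eq_inv]
      refine and_congr_right fun h1 => ?_
      rw [h1, inv_inv]
      constructor
      · intro h; rw [← h]; field_simp
      · intro h; rw [h]; field_simp

lemma erase_inv (S : Finset RatAff) (m : RatAff) : S⁻¹.erase m⁻¹ = (S.erase m)⁻¹ := by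
  ext x
  simp only [mem_erase, mem_inv', ne_eq]
  rw [inv_eq_iff_eq_inv]

/-- Without `t`, two products of `T * T` are lost, namely `t²` and `t` times the next largest
element, together with the larger of `m t` and `t m`. -/
lemma card_mul_insert_erase_max {T : Finset RatAff} (hT : ∀ x ∈ T, ∀ y ∈ T, Commute x y)
    {m t : RatAff} (hm : ∃ t ∈ T, ¬ Commute m t) (ht : t ∈ T) (hmax : ∀ x ∈ T, x ≤ t)
    (hne : (T.erase t).Nonempty) :
    #(insert m (T.erase t) * insert m (T.erase t)) + 3 ≤ #(insert m T * insert m T) := by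
  have e := card_mul_insert_of_commute hT hm
  set U := T.erase t with hU
  have hUT : U ⊆ T := erase_subset _ _
  have hlt : ∀ x ∈ U, x < t := fun x hx =>
    lt_of_le_of_ne (hmax x (hUT hx)) (ne_of_mem_erase hx)
  have e1 : #(insert m U * insert m U) ≤ #(U * U) + #({m} * U ∪ U * {m}) + 1 := by
    have : insert m U * insert m U ⊆ insert (m * m) (U * U ∪ ({m} * U ∪ U * {m})) := by
      intro z hz
      obtain ⟨a, ha, b, hb, rfl⟩ := mem_mul.1 hz
      rcases mem_insert.1 ha with ha' | ha' <;> rcases mem_insert.1 hb with hb' | hb'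
      · rw [ha', hb']; exact mem_insert_self _ _
      · rw [ha']
        exact mem_insert_of_mem (mem_union_right _ (mem_union_left _
          (mul_mem_mul (mem_singleton_self _) hb')))
      · rw [hb']
        exact mem_insert_of_mem (mem_union_right _ (mem_union_right _
          (mul_mem_mul ha' (mem_singleton_self _))))
      · exact mem_insert_of_mem (mem_union_left _ (mul_mem_mul ha' hb'))
    have h1 := card_le_card this
    have h2 := card_insert_le (m * m) (U * U ∪ ({m} * U ∪ U * {m}))
    have h3 := card_union_le (U * U) ({m} * U ∪ U * {m})
    omega
  have e2 : #(U * U) + 2 ≤ #(T * T) := by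
    obtain ⟨t', ht', hmax'⟩ : ∃ t' ∈ U, ∀ x ∈ U, x ≤ t' :=
      ⟨U.max' hne, U.max'_mem hne, fun x hx => U.le_max' x hx⟩
    have n1 : t * t ∉ U * U := by
      intro h
      obtain ⟨a, ha, b, hb, hab⟩ := mem_mul.1 h
      exact (mul_lt_of_lt_le (hlt a ha) (hlt b hb).le).ne hab
    have n2 : t * t' ∉ U * U := by
      intro h
      obtain ⟨a, ha, b, hb, hab⟩ := mem_mul.1 h
      exact (mul_lt_of_lt_le (hlt a ha) (hmax' b hb)).ne hab
    have n3 : t * t ∉ insert (t * t') (U * U) := by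
      simp only [mem_insert, not_or]
      exact ⟨(mul_lt_mul_right (hlt t' ht') t).ne', n1⟩
    have := card_le_card (show insert (t * t) (insert (t * t') (U * U)) ⊆ T * T by
      rw [insert_subset_iff, insert_subset_iff]
      exact ⟨mul_mem_mul ht ht, mul_mem_mul ht (hUT ht'), mul_subset_mul hUT hUT⟩)
    rw [card_insert_of_notMem n3, card_insert_of_notMem n2] at this
    omega
  have e3 : #({m} * U ∪ U * {m}) + 1 ≤ #({m} * T ∪ T * {m}) := by
    have key : ∃ z ∈ {m} * T ∪ T * {m}, z ∉ {m} * U ∪ U * {m} := by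
      rcases le_total (m * t) (t * m) with h | h
      · refine ⟨t * m, mem_union_right _ (mul_mem_mul ht (mem_singleton_self m)), fun hz => ?_⟩
        rcases mem_union.1 hz with hz | hz
        · obtain ⟨m', hm', a, ha, hz⟩ := mem_mul.1 hz
          rw [mem_singleton.1 hm'] at hz
          exact ((mul_lt_mul_right (hlt a ha) m).trans_le h).ne hz
        · obtain ⟨a, ha, m', hm', hz⟩ := mem_mul.1 hz
          rw [mem_singleton.1 hm'] at hz
          exact (mul_lt_mul_left (hlt a ha) m).ne hz
      · refine ⟨m * t, mem_union_left _ (mul_mem_mul (mem_singleton_self m) ht), fun hz => ?_⟩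
        rcases mem_union.1 hz with hz | hz
        · obtain ⟨m', hm', a, ha, hz⟩ := mem_mul.1 hz
          rw [mem_singleton.1 hm'] at hz
          exact (mul_lt_mul_right (hlt a ha) m).ne hz
        · obtain ⟨a, ha, m', hm', hz⟩ := mem_mul.1 hz
          rw [mem_singleton.1 hm'] at hz
          exact ((mul_lt_mul_left (hlt a ha) m).trans_le h).ne hz
    obtain ⟨z, hz, hz'⟩ := key
    rw [← card_insert_of_notMem hz']
    apply card_le_card
    rw [insert_subset_iff]
    exact ⟨hz, union_subset_union (mul_subset_mul_left hUT) (mul_subset_mul_right hUT)⟩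
  omega

/-- The classification of the noncommutative sets of `n` elements with the fewest products. -/
def Classified (n : ℕ) : Prop :=
  ∀ S : Finset RatAff, #S = n → Noncomm S → #(S * S) + 2 ≤ 3 * n →
    IsProg S ∨ n = 4 ∧ IsTri S

section step
variable {n : ℕ} {S : Finset RatAff}

/-- Deleting `t` leaves an extremal noncommutative set. It is not a progression, since distinct
elements of equal scale `b ≠ 1` do not commute. So it is `1, c, c²` and one element of scale `b`,
which has to be `m`; the powers of `c` lie on one side of 1. -/
lemma erase_max_sign (hn : 4 ≤ n) (ih : Classified n) {T : Finset RatAff} {m t : RatAff}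
    (hcard : #T = n) (hmT : m ∉ T) (hT : ∀ x ∈ T, ∀ y ∈ T, Commute x y)
    (hm : ∃ t ∈ T, ¬ Commute m t) (h : #(insert m T * insert m T) + 2 ≤ 3 * (n + 1))
    (ht : t ∈ T) (hmax : ∀ x ∈ T, x ≤ t) :
    1 ∈ T.erase t ∧ ((∀ x ∈ T.erase t, 1 ≤ x) ∨ ∀ x ∈ T.erase t, x ≤ 1) := by
  have hU : #(T.erase t) = n - 1 := by rw [card_erase_of_mem ht, hcard]
  have e := card_mul_insert_erase_max hT hm ht hmax (card_pos.1 (by omega))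
  have nc : ∀ x ∈ T, x ≠ 1 → ¬ Commute m x := by
    intro x hx hx1 hmx
    obtain ⟨y, hy, hmy⟩ := hm
    exact hmy (commute_trans hx1 hmx.symm (hT x hx y hy))
  obtain ⟨x, hx, y, hy, hxy⟩ := one_lt_card.1 (show 1 < #(T.erase t) by omega)
  have hmU : m ∉ T.erase t := fun h => hmT (mem_of_mem_erase h)
  have hN : Noncomm (insert m (T.erase t)) := by
    by_cases hx1 : x = 1
    · exact ⟨m, mem_insert_self _ _, y, mem_insert_of_mem hy,
        nc y (mem_of_mem_erase hy) (fun hy1 => hxy (hx1.trans hy1.symm))⟩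
    · exact ⟨m, mem_insert_self _ _, x, mem_insert_of_mem hx, nc x (mem_of_mem_erase hx) hx1⟩
  rcases ih _ (by rw [card_insert_of_notMem hmU]; omega) hN (by omega) with hP | ⟨-, hP⟩
  · exfalso
    obtain ⟨a, d, b, hd, hb, hP⟩ := hP
    have sx := ((hP x).1 (mem_insert_of_mem hx)).1
    have sy := ((hP y).1 (mem_insert_of_mem hy)).1
    have hc := hT x (mem_of_mem_erase hx) y (mem_of_mem_erase hy)
    rw [commute_iff, sx, sy] at hc
    apply hxy
    refine RatAff.ext (sx.trans sy.symm) (mul_left_cancel₀ ?_ hc).symm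
    rcases hb with rfl | rfl <;> norm_num
  · obtain ⟨d, b, v, hd, hb, hP⟩ := hP
    have hb1 : b - 1 ≠ 0 := by rcases hb with rfl | rfl <;> norm_num
    have hb0 : 0 < b := by rcases hb with rfl | rfl <;> norm_num
    have hone := (hP 1).2 (by simp)
    have hd1 := (hP ⟨1, d, one_pos⟩).2 (by simp)
    have hd2 := (hP ⟨1, 2 * d, one_pos⟩).2 (by simp)
    have hbv := (hP ⟨b, v, hb0⟩).2 (by simp)
    have hmb : (⟨b, v, hb0⟩ : RatAff) = m := by
      by_contra hne
      have hbT := mem_of_mem_erase (mem_of_mem_insert_of_ne hbv hne)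
      by_cases h1 : (⟨1, d, one_pos⟩ : RatAff) = m
      · have h2 : (⟨1, 2 * d, one_pos⟩ : RatAff) ≠ m := by
          rw [← h1]; intro h; rw [RatAff.ext_iff] at h
          apply hd; have := h.2; simp only at this; linarith
        have hc := hT _ hbT _ (mem_of_mem_erase (mem_of_mem_insert_of_ne hd2 h2))
        rw [commute_iff] at hc
        simp [hb1, hd] at hc
      · have hc := hT _ hbT _ (mem_of_mem_erase (mem_of_mem_insert_of_ne hd1 h1))
        rw [commute_iff] at hc
        simp [hb1, hd] at hc
    have h1m : (1 : RatAff) ≠ m := by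
      rintro rfl
      obtain ⟨y, hy, hmy⟩ := hm
      exact hmy (Commute.one_left y)
    refine ⟨mem_of_mem_insert_of_ne hone h1m, ?_⟩
    have hform : ∀ x ∈ T.erase t, x.scale = 1 ∧ (x.shift = 0 ∨ x.shift = d ∨ x.shift = 2 * d) := by
      intro x hx
      rcases (hP x).1 (mem_insert_of_mem hx) with h | h
      · exact h
      · exfalso; apply hmU
        rw [← hmb]
        rwa [show (⟨b, v, hb0⟩ : RatAff) = x from RatAff.ext h.1.symm h.2.symm]
    rcases lt_or_gt_of_ne hd with hd | hd
    · right
      intro x hx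
      obtain ⟨h1, h2⟩ := hform x hx
      rw [← not_lt, lt_iff]
      simp only [scale_one, shift_one, h1, lt_irrefl, false_or, true_and, not_lt]
      rcases h2 with h2 | h2 | h2 <;> rw [h2] <;> linarith
    · left
      intro x hx
      obtain ⟨h1, h2⟩ := hform x hx
      rw [← not_lt, lt_iff]
      simp only [scale_one, shift_one, h1, lt_irrefl, false_or, true_and, not_lt]
      rcases h2 with h2 | h2 | h2 <;> rw [h2] <;> linarith

/-- If `T` were commutative, `erase_max_sign` for `T` and `T⁻¹` would put 1 in `T` without its
maximum and in `T` without its minimum, each lying on one side of 1. Opposite sides force a middle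
element `y ≠ 1` to equal 1. Equal sides make 1 the very extreme element that was removed. -/
lemma noncomm_erase (hn : 4 ≤ n) (ih : Classified n) (hcard : #S = n + 1) (hS : Noncomm S)
    (h : #(S * S) + 2 ≤ 3 * (n + 1)) {m : RatAff} (hm : m ∈ S) : Noncomm (S.erase m) := by
  by_contra hT
  rw [not_noncomm] at hT
  set T := S.erase m with hTdef
  have hST : insert m T = S := insert_erase hm
  have hmT : m ∉ T := notMem_erase _ _
  have hTn : #T = n := by rw [hTdef, card_erase_of_mem hm, hcard]; rfl
  have hmc : ∃ t ∈ T, ¬ Commute m t := exists_not_commute_of_insert (hST ▸ hS) hT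
  have hne : T.Nonempty := card_pos.1 (by omega)
  have hmaxmem := T.max'_mem hne
  have hminmem := T.min'_mem hne
  obtain ⟨h1, h2⟩ := erase_max_sign hn ih hTn hmT hT hmc (by rw [hST]; exact h)
    hmaxmem (fun x hx => T.le_max' x hx)
  have hSi : insert m⁻¹ T⁻¹ = S⁻¹ := by rw [← hST, inv_insert]
  obtain ⟨h3, h4⟩ := erase_max_sign (T := T⁻¹) (m := m⁻¹) (t := (T.min' hne)⁻¹) hn ih
    (by rw [card_inv, hTn]) (by simpa using hmT)
    (fun x hx y hy => by
      have := hT x⁻¹ (mem_inv'.1 hx) y⁻¹ (mem_inv'.1 hy)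
      simpa using this.inv_inv)
    (by
      obtain ⟨t, ht, hmt⟩ := hmc
      exact ⟨t⁻¹, inv_mem_inv ht, fun hc => hmt (by simpa using hc.inv_inv)⟩)
    (by rw [hSi, card_inv_mul_inv]; exact h) (inv_mem_inv hminmem)
    (fun x hx => by
      have := T.min'_le _ (mem_inv'.1 hx)
      exact le_inv'.1 this)
  rw [erase_inv] at h3 h4
  rw [mem_inv', inv_one] at h3
  have h4' : (∀ x ∈ T.erase (T.min' hne), x ≤ 1) ∨ ∀ x ∈ T.erase (T.min' hne), 1 ≤ x := by
    refine h4.imp (fun h4 x hx => ?_) (fun h4 x hx => ?_)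
    · exact one_le_inv'.1 (h4 _ (inv_mem_inv hx))
    · exact inv_le_one'.1 (h4 _ (inv_mem_inv hx))
  obtain ⟨y, hy, hy1⟩ : ∃ y ∈ (T.erase (T.max' hne)).erase (T.min' hne), y ≠ 1 := by
    have hc : 1 < #((T.erase (T.max' hne)).erase (T.min' hne)) := by
      have := pred_card_le_card_erase (s := T.erase (T.max' hne)) (a := T.min' hne)
      rw [card_erase_of_mem hmaxmem] at this
      omega
    exact exists_mem_ne hc 1
  rw [mem_erase, mem_erase] at hy
  obtain ⟨hymin, hymax, hyT⟩ := hy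
  have yA : y ∈ T.erase (T.max' hne) := mem_erase.2 ⟨hymax, hyT⟩
  have yB : y ∈ T.erase (T.min' hne) := mem_erase.2 ⟨hymin, hyT⟩
  have hlt : T.min' hne < T.max' hne := by
    have := T.min'_le y hyT
    have := lt_of_le_of_ne (T.le_max' y hyT) hymax
    order
  rcases h2 with h2 | h2 <;> rcases h4' with h4' | h4'
  · exact hy1 (le_antisymm (h4' y yB) (h2 y yA))
  · have e1 := h2 _ (mem_erase.2 ⟨hlt.ne, hminmem⟩)
    have e2 := T.min'_le 1 (mem_of_mem_erase h1)
    exact ne_of_mem_erase h3 (le_antisymm e1 e2)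
  · have e1 := h4' _ (mem_erase.2 ⟨hlt.ne', hmaxmem⟩)
    have e2 := T.le_max' 1 (mem_of_mem_erase h1)
    exact ne_of_mem_erase h1 (le_antisymm e2 e1)
  · exact hy1 (le_antisymm (h2 y yA) (h4' y yB))

lemma erase_max (hn : 4 ≤ n) (ih : Classified n) (hcard : #S = n + 1) (hS : Noncomm S)
    (h : #(S * S) + 2 ≤ 3 * (n + 1)) {m : RatAff} (hm : m ∈ S) (hmax : ∀ x ∈ S, x ≤ m) :
    #(S.erase m * S.erase m) + 2 ≤ 3 * n ∧ (IsProg (S.erase m) ∨ n = 4 ∧ IsTri (S.erase m)) := by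
  have hN := noncomm_erase hn ih hcard hS h hm
  have e := card_mul_insert_max hN (m := m) (fun t ht =>
    lt_of_le_of_ne (hmax t (mem_of_mem_erase ht)) (ne_of_mem_erase ht))
  rw [insert_erase hm] at e
  have e' : #(S.erase m * S.erase m) + 2 ≤ 3 * n := by omega
  exact ⟨e', ih _ (by rw [card_erase_of_mem hm, hcard]; rfl) hN e'⟩

lemma erase_min (hn : 4 ≤ n) (ih : Classified n) (hcard : #S = n + 1) (hS : Noncomm S)
    (h : #(S * S) + 2 ≤ 3 * (n + 1)) {m : RatAff} (hm : m ∈ S) (hmin : ∀ x ∈ S, m ≤ x) :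
    IsProg (S.erase m) ∨ n = 4 ∧ IsTri (S.erase m) := by
  have hN := noncomm_erase hn ih hcard hS h hm
  have e := (erase_max (S := S⁻¹) (m := m⁻¹) hn ih (by rw [card_inv, hcard]) hS.inv
    (by rw [card_inv_mul_inv]; exact h) (inv_mem_inv hm)
    (fun x hx => le_inv'.1 (hmin _ (mem_inv'.1 hx)))).1
  rw [erase_inv, card_inv_mul_inv] at e
  exact ih _ (by rw [card_erase_of_mem hm, hcard]; rfl) hN e

/-- The two progressions share all elements but the extreme ones. Comparing first terms on the
overlap gives `a' = a + d`, and comparing second terms gives `d ≤ d'` and `d' ≤ d`. -/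
lemma isProg_of_erase (hn : 4 ≤ n) (hcard : #S = n + 1) {M N : RatAff} (hM : M ∈ S) (hN : N ∈ S)
    (hmax : ∀ x ∈ S, x ≤ M) (hmin : ∀ x ∈ S, N ≤ x) (h1 : IsProg (S.erase M))
    (h2 : IsProg (S.erase N)) : IsProg S := by
  obtain ⟨a, d, b, hd, hb, h1⟩ := h1
  obtain ⟨a', d', b', hd', hb', h2⟩ := h2
  rw [card_erase_of_mem hM, hcard, Nat.add_sub_cancel] at h1
  rw [card_erase_of_mem hN, hcard, Nat.add_sub_cancel] at h2
  have hb0 : 0 < b := by rcases hb with rfl | rfl <;> norm_num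
  have hb0' : 0 < b' := by rcases hb' with rfl | rfl <;> norm_num
  have hA : ∀ i : ℕ, i < n → (⟨b, a + i * d, hb0⟩ : RatAff) ∈ S.erase M := fun i hi =>
    (h1 _).2 ⟨rfl, i, hi, rfl⟩
  have hB : ∀ i : ℕ, i < n → (⟨b', a' + i * d', hb0'⟩ : RatAff) ∈ S.erase N := fun i hi =>
    (h2 _).2 ⟨rfl, i, hi, rfl⟩
  have notmin : ∀ i : ℕ, 1 ≤ i → i < n → (⟨b, a + i * d, hb0⟩ : RatAff) ∈ S.erase N := by
    intro i hi hin
    refine mem_erase.2 ⟨fun h => ?_, mem_of_mem_erase (hA i hin)⟩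
    have := hmin _ (mem_of_mem_erase (hA 0 (by omega)))
    rw [← h, ← not_lt, lt_iff] at this
    apply this
    right
    refine ⟨rfl, ?_⟩
    have : (1 : ℚ) ≤ i := by exact_mod_cast hi
    simp only [Nat.cast_zero, zero_mul]
    nlinarith
  have notmax : ∀ i : ℕ, i + 1 < n → (⟨b', a' + i * d', hb0'⟩ : RatAff) ∈ S.erase M := by
    intro i hin
    refine mem_erase.2 ⟨fun h => ?_, mem_of_mem_erase (hB i (by omega))⟩
    have := hmax _ (mem_of_mem_erase (hB (i + 1) hin))
    rw [← h, ← not_lt, lt_iff] at this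
    apply this
    right
    refine ⟨rfl, ?_⟩
    push_cast
    nlinarith
  obtain ⟨hbb, j1, hj1, e1⟩ := (h2 _).1 (notmin 1 le_rfl (by omega))
  obtain ⟨-, j2, hj2, e2⟩ := (h2 _).1 (notmin 2 (by omega) (by omega))
  obtain ⟨-, i0, hi0, f0⟩ := (h1 _).1 (notmax 0 (by omega))
  obtain ⟨-, i1, hi1, f1⟩ := (h1 _).1 (notmax 1 (by omega))
  simp only at hbb e1 e2 f0 f1
  subst hbb
  push_cast at e1 e2 f0 f1
  have hi0' : i0 ≠ 0 := by
    rintro rfl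
    have hN' : (⟨b, a' + (0 : ℕ) * d', hb0'⟩ : RatAff) = N := by
      by_contra hne
      obtain ⟨sN, i, hi, e⟩ := (h1 N).1 (mem_erase.2 ⟨by
        rintro rfl
        have h3 := hmin _ (mem_of_mem_erase (hB 0 (by omega)))
        have h4 := hmax _ (mem_of_mem_erase (hB 0 (by omega)))
        exact hne (le_antisymm h4 h3), hN⟩)
      have := hmin _ (mem_of_mem_erase (hB 0 (by omega)))
      rw [← not_lt, lt_iff] at this
      simp only [sN, true_and, not_or, not_lt, e] at this
      have h0 : (0 : ℚ) ≤ i * d := by positivity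
      apply hne
      refine RatAff.ext sN.symm ?_
      rw [e]
      push_cast at *
      linarith [this.2]
    exact ne_of_mem_erase (hB 0 (by omega)) hN'
  have hi0q : (1 : ℚ) ≤ i0 := by exact_mod_cast Nat.one_le_iff_ne_zero.2 hi0'
  have hj1q : (0 : ℚ) ≤ j1 := by positivity
  have ha' : a' = a + d := by nlinarith
  have hj2q : (1 : ℚ) ≤ j2 := by
    have : j2 ≠ 0 := by
      rintro rfl
      push_cast at e2
      linarith
    exact_mod_cast Nat.one_le_iff_ne_zero.2 this
  have hi1q : (2 : ℚ) ≤ i1 := by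
    have h0 : i1 ≠ 0 := by
      rintro rfl
      push_cast at f1
      linarith
    have h1 : i1 ≠ 1 := by
      rintro rfl
      push_cast at f1
      linarith
    have : 2 ≤ i1 := by omega
    exact_mod_cast this
  have hdd : d' = d := by nlinarith
  subst hdd
  refine ⟨a, d', b, hd, hb, fun x => ?_⟩
  rw [hcard]
  constructor
  · intro hx
    by_cases hxN : x = N
    · by_cases hxM : x = M
      · exfalso
        have := card_le_one.2 (fun y hy z hz => by
          have h3 := hmin y hy
          have h4 := hmax y hy
          have h5 := hmin z hz
          have h6 := hmax z hz
          rw [← hxN, hxM] at h3 h5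
          exact (le_antisymm h4 h3).trans (le_antisymm h6 h5).symm : ∀ y ∈ S, ∀ z ∈ S, y = z)
        omega
      · obtain ⟨h3, i, hi, h4⟩ := (h1 x).1 (mem_erase.2 ⟨hxM, hx⟩)
        exact ⟨h3, i, by omega, h4⟩
    · obtain ⟨h3, i, hi, h4⟩ := (h2 x).1 (mem_erase.2 ⟨hxN, hx⟩)
      refine ⟨h3, i + 1, by omega, ?_⟩
      rw [h4, ha']; push_cast; ring
  · rintro ⟨h3, i, hi, h4⟩
    by_cases hin : i < n
    · exact mem_of_mem_erase ((h1 x).2 ⟨h3, i, hin, h4⟩)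
    · refine mem_of_mem_erase ((h2 x).2 ⟨h3, i - 1, by omega, ?_⟩)
      rw [h4, ha', Nat.cast_sub (by omega)]; push_cast; ring

end step

end RatAff

/-! ### Excluding the exceptional shape beyond four elements. -/

namespace RatAff
open Finset

/-- The maximum of a five-element set with few products does not complete a set `1, c, c², x`. -/
lemma not_isTri_erase_max {S : Finset RatAff} (ih : Classified 4) (hcard : #S = 5)
    (hS : Noncomm S) (h : #(S * S) ≤ 13) {M : RatAff} (hM : M ∈ S) (hmax : ∀ x ∈ S, x ≤ M) :
    ¬ IsTri (S.erase M) := by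
  rintro ⟨d, b, v, hd, hb, hT⟩
  have hb1 : b ≠ 1 := by rcases hb with rfl | rfl <;> norm_num
  have hb0 : 0 < b := by rcases hb with rfl | rfl <;> norm_num
  have m0 := (hT 1).2 (by simp)
  have m1 := (hT ⟨1, d, one_pos⟩).2 (by simp)
  have m2 := (hT ⟨1, 2 * d, one_pos⟩).2 (by simp)
  have mx := (hT ⟨b, v, hb0⟩).2 (by simp)
  have hM1 : (1 : RatAff) < M :=
    lt_of_le_of_ne (hmax _ (mem_of_mem_erase m0)) (ne_of_mem_erase m0)
  have others : ∀ x ∈ S, x ≠ M → x ≠ ⟨b, v, hb0⟩ → x.scale = 1 ∧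
      (x.shift = 0 ∨ x.shift = d ∨ x.shift = 2 * d) := by
    intro x hx hxM hxb
    rcases (hT x).1 (mem_erase.2 ⟨hxM, hx⟩) with h | h
    · exact h
    · exact absurd (RatAff.ext h.1 h.2) hxb
  -- If the maximum had scale 1, deleting `x` would leave only translations, a commutative set.
  have hMs : 1 < M.scale := by
    rw [lt_iff] at hM1
    rcases hM1 with h1 | ⟨h1, -⟩
    · exact h1
    · exfalso
      obtain ⟨x, hx, y, hy, hxy⟩ := noncomm_erase le_rfl ih hcard hS (by omega)
        (mem_of_mem_erase mx)
      have hs : ∀ x ∈ S.erase ⟨b, v, hb0⟩, x.scale = 1 := by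
        intro x hx
        by_cases hxM : x = M
        · rw [hxM]; exact h1.symm
        · exact (others x (mem_of_mem_erase hx) hxM (ne_of_mem_erase hx)).1
      apply hxy
      rw [commute_iff, hs x hx, hs y hy]; simp
  rcases hb with rfl | rfl
  · -- `x` and the maximum both have scale above `1`
    have hne : S.Nonempty := ⟨M, hM⟩
    have hNm := S.min'_mem hne
    set N := S.min' hne with hN
    have hN1 : N ≤ 1 := S.min'_le _ (mem_of_mem_erase m0)
    have hNs : N.scale ≤ 1 := by
      by_contra! hlt
      exact absurd hN1 (not_le.2 ((lt_iff _ _).2 (Or.inl hlt)))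
    have hNM : N ≠ M := by rintro h; rw [h] at hNs; linarith
    have hNx : N ≠ ⟨2, v, hb0⟩ := by rintro h; rw [h] at hNs; norm_num at hNs
    have hNT := others N hNm hNM hNx
    have xN : (⟨2, v, hb0⟩ : RatAff) ∈ S.erase N :=
      mem_erase.2 ⟨hNx.symm, mem_of_mem_erase mx⟩
    rcases erase_min le_rfl ih hcard hS (by omega) hNm (fun x hx => S.min'_le x hx) with
      hP | ⟨-, hP⟩
    · obtain ⟨a, d', b', hd', hb', hP⟩ := hP
      have e1 := ((hP _).1 xN).1
      have : ∃ y ∈ S.erase N, y.scale = 1 := by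
        by_cases h1 : N = 1
        · exact ⟨_, mem_erase.2 ⟨fun h => hd (by rw [h1] at h; exact congrArg shift h),
            mem_of_mem_erase m1⟩, rfl⟩
        · exact ⟨1, mem_erase.2 ⟨Ne.symm h1, mem_of_mem_erase m0⟩, rfl⟩
      obtain ⟨y, hy, hys⟩ := this
      have e2 := ((hP y).1 hy).1
      simp only at e1
      rw [hys, ← e1] at e2
      norm_num at e2
    · obtain ⟨d', b', v', hd', hb', hP⟩ := hP
      have n0 := (hP 1).2 (by simp)
      have n1 := (hP ⟨1, d', one_pos⟩).2 (by simp)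
      have n2 := (hP ⟨1, 2 * d', one_pos⟩).2 (by simp)
      have hle : shifts S 1 ⊆ {0, d, 2 * d} := by
        intro q hq
        obtain ⟨x, hx, hxs, rfl⟩ := mem_shifts.1 hq
        have := (others x hx (by rintro rfl; linarith)
          (by rintro rfl; norm_num at hxs)).2
        simpa using this
      -- Without the minimum `N` there are still three translations, and `N` is a fourth; but only
      -- `1, c, c²` are available.
      have hge : 4 ≤ #(shifts S 1) := by
        apply length_le_card (l := [0, d', 2 * d', N.shift])
        · have hne' : ∀ q : ℚ, (⟨1, q, one_pos⟩ : RatAff) ∈ S.erase N → q ≠ N.shift := by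
            intro q hq h
            exact ne_of_mem_erase hq (RatAff.ext hNT.1.symm h)
          simp only [List.nodup_cons, List.mem_cons, List.not_mem_nil, or_false, not_or,
            not_false_eq_true, List.nodup_nil, and_true]
          refine ⟨⟨hd'.symm, ?_, hne' 0 n0⟩, ⟨?_, hne' _ n1⟩, hne' _ n2⟩
          · intro h; apply hd'; linarith
          · intro h; apply hd'; linarith
        · simp only [List.mem_cons, List.not_mem_nil, or_false]
          rintro q (rfl | rfl | rfl | rfl)
          · exact mem_shifts.2 ⟨_, mem_of_mem_erase n0, rfl, rfl⟩
          · exact mem_shifts.2 ⟨_, mem_of_mem_erase n1, rfl, rfl⟩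
          · exact mem_shifts.2 ⟨_, mem_of_mem_erase n2, rfl, rfl⟩
          · exact mem_shifts.2 ⟨_, hNm, hNT.1, rfl⟩
      have h3 : #({0, d, 2 * d} : Finset ℚ) ≤ 3 := card_le_three
      have := card_le_card hle
      omega
  · -- `x` has scale below `1`
    have hN : Noncomm (S.erase M) := noncomm_erase le_rfl ih hcard hS (by omega) hM
    have e := three_mul_card_le hN
    rw [card_erase_of_mem hM, hcard] at e
    have hsc : ∀ x ∈ S.erase M, x.scale ≤ 1 := by
      intro x hx
      rcases (hT x).1 hx with h | h
      · exact h.1.le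
      · rw [h.1]; norm_num
    have hprod : ∀ z ∈ S.erase M * S.erase M, z.scale ≤ 1 := by
      intro z hz
      obtain ⟨x, hx, y, hy, rfl⟩ := mem_mul.1 hz
      exact mul_le_one₀ (hsc x hx) y.scale_pos.le (hsc y hy)
    have hnot : ∀ z : RatAff, 1 < z.scale → z ∉ S.erase M * S.erase M := fun z hz hz' =>
      absurd (hprod z hz') (not_le.2 hz)
    -- The products `M`, `M c`, `M c²`, `M²` have scale above 1, while all products without `M` have
    -- scale at most 1. This gives 10 + 4 > 13.
    have := card_add_four_le (mul_subset_mul (erase_subset M S) (erase_subset M S))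
      (mul_mem_mul hM (mem_of_mem_erase m0)) (mul_mem_mul hM (mem_of_mem_erase m1))
      (mul_mem_mul hM (mem_of_mem_erase m2)) (mul_mem_mul hM hM)
      (hnot _ (by simpa using hMs)) (hnot _ (by simpa using hMs)) (hnot _ (by simpa using hMs))
      (hnot _ (by rw [scale_mul]; nlinarith)) (by
        simp only [List.nodup_cons, List.mem_cons, List.not_mem_nil, or_false, not_or,
          not_false_eq_true, List.nodup_nil, and_true, mul_right_inj]
        refine ⟨⟨?_, ?_, (ne_of_mem_erase m0)⟩, ⟨?_, ne_of_mem_erase m1⟩, ne_of_mem_erase m2⟩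
        all_goals
          intro h
          have := congrArg shift h
          simp only [shift_one] at this
          apply hd
          linarith)
    omega

lemma classified_succ {n : ℕ} (hn : 4 ≤ n) (ih : Classified n) : Classified (n + 1) := by
  intro S hcard hS h
  have hne : S.Nonempty := card_pos.1 (by omega)
  have hM := S.max'_mem hne
  have hN := S.min'_mem hne
  have hmax : ∀ x ∈ S, x ≤ S.max' hne := fun x hx => S.le_max' x hx
  have hmin : ∀ x ∈ S, S.min' hne ≤ x := fun x hx => S.min'_le x hx
  left
  rcases (erase_max hn ih hcard hS h hM hmax).2 with h1 | ⟨rfl, h1⟩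
  · rcases erase_min hn ih hcard hS h hN hmin with h2 | ⟨rfl, h2⟩
    · exact isProg_of_erase hn hcard hM hN hmax hmin h1 h2
    · exfalso
      refine not_isTri_erase_max (S := S⁻¹) (M := (S.min' hne)⁻¹) ih (by rw [card_inv, hcard])
        hS.inv (by rw [card_inv_mul_inv]; omega) (inv_mem_inv hN)
        (fun x hx => le_inv'.1 (hmin _ (mem_inv'.1 hx))) ?_
      rw [erase_inv]
      exact h2.inv
  · exact absurd h1 (not_isTri_erase_max ih hcard hS (by omega) hM hmax)

/-- The noncommutative finite sets with at least four elements and the fewest products. -/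
theorem classified {n : ℕ} (hn : 4 ≤ n) : Classified n := by
  induction n, hn using Nat.le_induction with
  | base =>
    intro S h4 hS h
    exact (isProg_or_isTri_of_card_four h4 hS (by omega)).imp_right fun h => ⟨rfl, h⟩
  | succ n hn ih => exact classified_succ hn ih

end RatAff

/-! ### Counting products of the extremal sets in an arbitrary group. -/

section products
variable {G : Type*} [Group G] {x c : G}

lemma mul_eq_of_conjBy_eq {g h x : G} (H : conjBy g x = h) : g * x = x * h := by
  rw [← H, conjBy]; group

lemma ncard_le_of_subset_list {α : Type*} {A : Set α} (l : List α) (h : ∀ z ∈ A, z ∈ l) :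
    A.ncard ≤ l.length := by
  classical
  calc A.ncard ≤ (l.toFinset : Set α).ncard :=
        Set.ncard_le_ncard (fun z hz => by simpa using h z hz) (Finset.finite_toSet _)
    _ = l.toFinset.card := Set.ncard_coe_finset _
    _ ≤ l.length := List.toFinset_card_le l

/-- Moving `c ^ i` or `c ^ j` across `x` doubles or halves its exponent, so a product depends only
on `2 i + j`, respectively `i + 2 j`, which is at most `3 (k - 1)`. -/
lemma ncard_geomProg_mul_le (h : DoublingRel c x) (k : ℕ) :
    (geomProg x c k * geomProg x c k).ncard ≤ 3 * k - 2 := by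
  rcases h with h | h
  · have hx : c * x = x * c ^ 2 := mul_eq_of_conjBy_eq h
    have hpow : ∀ i : ℕ, c ^ i * x = x * c ^ (2 * i) := by
      intro i
      have : SemiconjBy x (c ^ 2) c := hx.symm
      rw [pow_mul]
      exact (this.pow_right i).symm
    have := ncard_le_of_subset_list (A := geomProg x c k * geomProg x c k)
      ((List.range (3 * k - 2)).map fun n => x * x * c ^ n) (by
        rintro z ⟨_, ⟨i, hi, rfl⟩, _, ⟨j, hj, rfl⟩, rfl⟩
        refine List.mem_map.2 ⟨2 * i + j, List.mem_range.2 (by omega), ?_⟩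
        simp only
        rw [pow_add, mul_assoc x x, ← mul_assoc x (c ^ (2 * i)), ← hpow]; simp only [mul_assoc])
    simpa using this
  · have hx : c ^ 2 * x = x * c := mul_eq_of_conjBy_eq h
    have hpow : ∀ i : ℕ, x * c ^ i = c ^ (2 * i) * x := by
      intro i
      have : SemiconjBy x c (c ^ 2) := hx.symm
      rw [pow_mul]
      exact this.pow_right i
    have := ncard_le_of_subset_list (A := geomProg x c k * geomProg x c k)
      ((List.range (3 * k - 2)).map fun n => x * c ^ n * x) (by
        rintro z ⟨_, ⟨i, hi, rfl⟩, _, ⟨j, hj, rfl⟩, rfl⟩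
        refine List.mem_map.2 ⟨i + 2 * j, List.mem_range.2 (by omega), ?_⟩
        simp only
        rw [hpow j, pow_add]; simp only [mul_assoc])
    simpa using this

/-- Five powers of `c`, the square of `x`, and only four mixed products, with exponents 0, 1, 2, 4
when all powers of `c` are collected on one side. -/
lemma ncard_triple_mul_le (h : DoublingRel c x) :
    (({1, c, c ^ 2, x} : Set G) * {1, c, c ^ 2, x}).ncard ≤ 10 := by
  have h4 : (c ^ 2) ^ 2 = c ^ 4 := (pow_mul c 2 2).symm
  rcases h with h | h
  · have h1 : c * x = x * c ^ 2 := mul_eq_of_conjBy_eq h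
    have h2 : c ^ 2 * x = x * c ^ 4 := by
      rw [pow_two, mul_assoc, h1, ← mul_assoc, h1, mul_assoc, ← pow_add]
    refine ncard_le_of_subset_list [1, c, c ^ 2, c ^ 3, c ^ 4, x, x * c, x * c ^ 2, x * c ^ 4,
      x * x] ?_
    rintro z ⟨u, hu, v, hv, rfl⟩
    simp only [Set.mem_insert_iff, Set.mem_singleton_iff] at hu hv
    rcases hu with rfl | rfl | rfl | rfl <;> rcases hv with rfl | hv | hv | hv <;>
      (try subst hv) <;> simp [h1, h2, h4, ← pow_succ, ← pow_succ', ← pow_two]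
  · have h1 : x * c = c ^ 2 * x := (mul_eq_of_conjBy_eq h).symm
    have h2 : x * c ^ 2 = c ^ 4 * x := by
      rw [pow_two, ← mul_assoc, h1, mul_assoc, h1, ← mul_assoc, ← pow_add]
    refine ncard_le_of_subset_list [1, c, c ^ 2, c ^ 3, c ^ 4, x, c * x, c ^ 2 * x, c ^ 4 * x,
      x * x] ?_
    rintro z ⟨u, hu, v, hv, rfl⟩
    simp only [Set.mem_insert_iff, Set.mem_singleton_iff] at hu hv
    rcases hu with rfl | rfl | rfl | rfl <;> rcases hv with rfl | hv | hv | hv <;>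
      (try subst hv) <;> simp [h1, h2, h4, ← pow_succ, ← pow_succ', ← pow_two]

lemma geomProg_inv (x c : G) (k : ℕ) : geomProg (x * c ^ k) c⁻¹ (k + 1) = geomProg x c (k + 1) := by
  have key : ∀ i : ℕ, i < k + 1 → x * c ^ k * c⁻¹ ^ i = x * c ^ (k - i) := by
    intro i hi
    rw [mul_assoc, inv_pow, ← pow_sub c (by omega)]
  ext g
  constructor
  · rintro ⟨i, hi, rfl⟩
    exact ⟨k - i, by omega, key i hi⟩
  · rintro ⟨i, hi, rfl⟩
    refine ⟨k - i, by omega, ?_⟩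
    rw [key _ (by omega)]
    congr 2
    omega

lemma conjBy_inv (g x : G) : conjBy g⁻¹ x = (conjBy g x)⁻¹ := by
  simp only [conjBy]; group

lemma conjBy_mul_of_commute {g x y : G} (h : Commute (conjBy g x) y) :
    conjBy g (x * y) = conjBy g x := by
  have : conjBy g (x * y) = y⁻¹ * (conjBy g x * y) := by simp only [conjBy]; group
  rw [this, h.eq]; group

/-- This reverses a progression: its last term is the new base point, and the extra factor `c ^ k`
does not affect the conjugate, a power of `c`. -/
lemma DoublingRel.inv (h : DoublingRel c x) (k : ℕ) : DoublingRel c⁻¹ (x * c ^ k) := by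
  rcases h with h | h
  · left
    have hc : Commute (conjBy c x) (c ^ k) := by rw [h]; exact Commute.pow_pow_self c 2 k
    rw [conjBy_inv, conjBy_mul_of_commute hc, h, inv_pow]
  · right
    have hc : Commute (conjBy (c ^ 2) x) (c ^ k) := by rw [h]; exact Commute.self_pow c k
    rw [inv_pow, conjBy_inv, conjBy_mul_of_commute hc, h]

/-- A progression can be written with ratio above `1` in any group order. -/
lemma exists_geomProg_one_lt {o : LinearOrder G} (ho : IsGroupOrder o) {k : ℕ} (hk : 0 < k)
    (hc : c ≠ 1) (h : DoublingRel c x) :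
    ∃ x' c' : G, o.lt 1 c' ∧ DoublingRel c' x' ∧ geomProg x c k = geomProg x' c' k := by
  rcases o.le_total 1 c with hle | hle
  · exact ⟨x, c, @lt_of_le_of_ne _ o.toPartialOrder _ _ hle hc.symm, h, rfl⟩
  · obtain ⟨m, rfl⟩ : ∃ m, k = m + 1 := ⟨k - 1, by omega⟩
    refine ⟨x * c ^ m, c⁻¹, ?_, h.inv m, (geomProg_inv x c m).symm⟩
    have := ho c 1 c⁻¹ 1 hle
    simp only [inv_mul_cancel, mul_one] at this
    exact @lt_of_le_of_ne _ o.toPartialOrder _ _ this (fun h => hc (inv_eq_one.1 h.symm))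

end products

/-! ### Transfer along an injective homomorphism into the affine group. -/

section embedding
open RatAff
variable {G : Type*} [Group G] {φ : G →* RatAff}

lemma RatAff.pow_of_scale_one {z : RatAff} (hz : z.scale = 1) (i : ℕ) :
    (z ^ i).scale = 1 ∧ (z ^ i).shift = i * z.shift := by
  induction i with
  | zero => simp
  | succ i ih =>
    rw [pow_succ, scale_mul, shift_mul, ih.1, ih.2, hz]
    exact ⟨one_mul 1, by push_cast; ring⟩

/-- Conjugating a translation, `x⁻¹ c x`, divides its shift by the scale of `x`. -/
lemma doublingRel_of_scale (hφ : Function.Injective φ) {c x : G} (hc : (φ c).scale = 1)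
    (hx : (φ x).scale = 2 ∨ (φ x).scale = 1 / 2) : DoublingRel c x := by
  have h2 := pow_of_scale_one hc 2
  push_cast at h2
  rcases hx with hx | hx
  · right
    apply hφ
    simp only [conjBy, map_mul, map_inv, map_pow]
    ext
    · simp [h2.1, hx, hc]
    · simp only [shift_mul, scale_mul, scale_inv, shift_inv, h2.1, h2.2, hx]; ring
  · left
    apply hφ
    simp only [conjBy, map_mul, map_inv, map_pow]
    ext
    · simp [h2.1, hx, hc]
    · simp only [shift_mul, scale_mul, scale_inv, shift_inv, h2.2, hc, hx]; ring

/-- The image of a finite set, as a finset. -/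
noncomputable def imageFinset (φ : G →* RatAff) {S : Set G} (hS : S.Finite) : Finset RatAff :=
  (hS.image φ).toFinset

lemma mem_imageFinset {S : Set G} (hS : S.Finite) {z : RatAff} :
    z ∈ imageFinset φ hS ↔ ∃ g ∈ S, φ g = z := by
  simp [imageFinset]

lemma map_mem_imageFinset (hφ : Function.Injective φ) {S : Set G} (hS : S.Finite) {g : G} :
    φ g ∈ imageFinset φ hS ↔ g ∈ S := by
  rw [mem_imageFinset]
  exact ⟨fun ⟨h, hh, e⟩ => hφ e ▸ hh, fun h => ⟨g, h, rfl⟩⟩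

lemma coe_imageFinset {S : Set G} (hS : S.Finite) : (imageFinset φ hS : Set RatAff) = φ '' S := by
  simp [imageFinset]

lemma card_imageFinset (hφ : Function.Injective φ) {S : Set G} (hS : S.Finite) :
    (imageFinset φ hS).card = S.ncard := by
  rw [← Set.ncard_coe_finset, coe_imageFinset, Set.ncard_image_of_injective _ hφ]

lemma card_imageFinset_mul (hφ : Function.Injective φ) {S : Set G} (hS : S.Finite) :
    (imageFinset φ hS * imageFinset φ hS).card = (S * S).ncard := by
  rw [← Set.ncard_coe_finset, Finset.coe_mul, coe_imageFinset, ← Set.image_mul,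
    Set.ncard_image_of_injective _ hφ]

lemma exists_geomProg_of_isProg (hφ : Function.Injective φ) {S : Set G} (hS : S.Finite)
    (hk : 2 ≤ S.ncard) (h : IsProg (imageFinset φ hS)) :
    ∃ x c : G, c ≠ 1 ∧ DoublingRel c x ∧ S = geomProg x c S.ncard := by
  obtain ⟨a, d, b, hd, hb, h⟩ := h
  rw [card_imageFinset hφ] at h
  have hb0 : 0 < b := by rcases hb with rfl | rfl <;> norm_num
  obtain ⟨x, -, hx⟩ := (mem_imageFinset hS).1 ((h ⟨b, a, hb0⟩).2 ⟨rfl, 0, by omega, by simp⟩)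
  obtain ⟨y, -, hy⟩ := (mem_imageFinset hS).1 ((h ⟨b, a + d, hb0⟩).2 ⟨rfl, 1, by omega, by simp⟩)
  have hc1 : (φ (x⁻¹ * y)).scale = 1 := by simp [hx, hy, hb0.ne']
  have hc2 : (φ (x⁻¹ * y)).shift = b⁻¹ * d := by simp [hx, hy]; ring
  refine ⟨x, x⁻¹ * y, ?_, doublingRel_of_scale hφ hc1 (by rw [hx]; exact hb), ?_⟩
  · intro h1
    rw [h1, map_one, shift_one] at hc2
    exact (mul_pos (inv_pos.2 hb0) hd).ne hc2
  · ext g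
    rw [← map_mem_imageFinset hφ hS, h]
    have hpow : ∀ i : ℕ, φ (x * (x⁻¹ * y) ^ i) = ⟨b, a + i * d, hb0⟩ := by
      intro i
      obtain ⟨e1, e2⟩ := pow_of_scale_one hc1 i
      rw [map_mul, map_pow, hx]
      ext
      · simp only [scale_mul, e1, mul_one]
      · simp only [shift_mul, e2, hc2]; field_simp
    constructor
    · rintro ⟨h1, i, hi, h2⟩
      exact ⟨i, hi, hφ (by rw [hpow]; exact RatAff.ext h1 h2)⟩
    · rintro ⟨i, hi, rfl⟩
      rw [hpow]
      exact ⟨rfl, i, hi, rfl⟩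

lemma exists_triple_of_isTri (hφ : Function.Injective φ) {S : Set G} (hS : S.Finite)
    (h : IsTri (imageFinset φ hS)) :
    ∃ x c : G, DoublingRel c x ∧ S = {1, c, c ^ 2, x} := by
  obtain ⟨d, b, v, hd, hb, h⟩ := h
  have hb0 : 0 < b := by rcases hb with rfl | rfl <;> norm_num
  obtain ⟨x, -, hx⟩ := (mem_imageFinset hS).1 ((h ⟨b, v, hb0⟩).2 (by simp))
  obtain ⟨c, -, hc⟩ := (mem_imageFinset hS).1 ((h ⟨1, d, one_pos⟩).2 (by simp))
  have hc1 : (φ c).scale = 1 := by rw [hc]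
  have hc2 := pow_of_scale_one hc1 2
  rw [← map_pow, hc] at hc2
  push_cast at hc2
  refine ⟨x, c, doublingRel_of_scale hφ hc1 (by rw [hx]; exact hb), ?_⟩
  ext g
  rw [← map_mem_imageFinset hφ hS, h]
  simp only [Set.mem_insert_iff, Set.mem_singleton_iff]
  rw [← hφ.eq_iff (b := (1 : G)), ← hφ.eq_iff (b := c), ← hφ.eq_iff (b := c ^ 2),
    ← hφ.eq_iff (b := x), RatAff.ext_iff, RatAff.ext_iff, RatAff.ext_iff, RatAff.ext_iff,
    hc2.1, hc2.2, hx, hc, map_one]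
  simp only [scale_one, shift_one, and_or_left, or_assoc]

lemma three_mul_ncard_sub_two_le (hφ : Function.Injective φ) {S : Set G} (hS : S.Finite)
    (hn : Noncomm (imageFinset φ hS)) : 3 * S.ncard - 2 ≤ (S * S).ncard := by
  have := three_mul_card_le hn
  rw [card_imageFinset hφ, card_imageFinset_mul hφ] at this
  omega

end embedding

/-! ### The faithful affine action of BS(1,2). -/

namespace BS12
open RatAff

/-- The affine maps assigned to the two generators. -/
def generatorAction : Fin 2 → RatAff := ![⟨1, 1, one_pos⟩, ⟨1 / 2, 0, by norm_num⟩]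

/-- The affine action of `BS(1,2)` on the rational line. -/
def toRatAff : BS12 →* RatAff :=
  PresentedGroup.toGroup (f := generatorAction) (by
    rintro r rfl
    simp only [map_mul, map_inv, map_pow, FreeGroup.lift_apply_of, generatorAction,
      Matrix.cons_val_zero, Matrix.cons_val_one]
    ext <;> norm_num [pow_two])

/-- The generator `a`. -/
def genA : BS12 := PresentedGroup.of 0

/-- The generator `b`. -/
def genB : BS12 := PresentedGroup.of 1

lemma toRatAff_genA : toRatAff genA = ⟨1, 1, one_pos⟩ :=
  PresentedGroup.toGroup.of _

lemma toRatAff_genB : toRatAff genB = ⟨1 / 2, 0, by norm_num⟩ :=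
  PresentedGroup.toGroup.of _

lemma genA_mul_genB : genA * genB = genB * genA ^ 2 := by
  have h : (PresentedGroup.mk _ ((FreeGroup.of 1)⁻¹ * FreeGroup.of 0 * FreeGroup.of 1 *
      (FreeGroup.of 0 ^ 2)⁻¹) : BS12) = 1 :=
    PresentedGroup.one_of_mem (Set.mem_singleton _)
  rw [map_mul, mul_eq_one_iff_eq_inv] at h
  simp only [map_mul, map_inv, map_pow, inv_inv] at h
  have h' : genB⁻¹ * genA * genB = genA ^ 2 := h
  rw [← h']; group

lemma genA_zpow_mul_genB (n : ℤ) : genA ^ n * genB = genB * genA ^ (2 * n) := by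
  have : SemiconjBy genB (genA ^ 2) genA := genA_mul_genB.symm
  rw [zpow_mul, zpow_ofNat]
  exact (this.zpow_right n).symm

lemma genA_zpow_mul_genB_pow (n : ℤ) (i : ℕ) :
    genA ^ n * genB ^ i = genB ^ i * genA ^ (2 ^ i * n) := by
  induction i generalizing n with
  | zero => simp
  | succ i ih =>
    rw [pow_succ' genB, ← mul_assoc, genA_zpow_mul_genB, mul_assoc, ih, ← mul_assoc]
    congr 2
    ring

/-- The relation gives `a b = b a²` and `b⁻¹ a = a² b⁻¹`, so positive powers of `b` collect on the
left and negative ones on the right. -/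
lemma exists_normal_form (g : BS12) :
    ∃ (i j : ℕ) (n : ℤ), g = genB ^ i * genA ^ n * (genB ^ j)⁻¹ := by
  have hA : ∀ (m : ℤ) (g : BS12), (∃ (i j : ℕ) (n : ℤ), g = genB ^ i * genA ^ n * (genB ^ j)⁻¹) →
      ∃ (i j : ℕ) (n : ℤ), genA ^ m * g = genB ^ i * genA ^ n * (genB ^ j)⁻¹ := by
    rintro m g ⟨i, j, n, rfl⟩
    refine ⟨i, j, 2 ^ i * m + n, ?_⟩
    rw [← mul_assoc, ← mul_assoc, genA_zpow_mul_genB_pow, zpow_add]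
    simp only [mul_assoc]
  have hg : g ∈ Subgroup.closure (Set.range (PresentedGroup.of : Fin 2 → BS12)) := by
    rw [PresentedGroup.closure_range_of]; trivial
  induction hg using Subgroup.closure_induction_left with
  | one => exact ⟨0, 0, 0, by simp⟩
  | mul_left x hx y hy ih =>
    obtain ⟨k, rfl⟩ := hx
    fin_cases k
    · have := hA 1 y ih
      rwa [zpow_one] at this
    · obtain ⟨i, j, n, rfl⟩ := ih
      refine ⟨i + 1, j, n, ?_⟩
      change genB * _ = _
      rw [pow_succ' genB]; simp only [mul_assoc]
  | inv_mul_cancel x hx y hy ih =>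
    obtain ⟨k, rfl⟩ := hx
    fin_cases k
    · have := hA (-1) y ih
      rwa [zpow_neg_one] at this
    · obtain ⟨i, j, n, rfl⟩ := ih
      change ∃ (i' j' : ℕ) (n' : ℤ), genB⁻¹ * _ = _
      cases i with
      | zero =>
        refine ⟨0, j + 1, 2 * n, ?_⟩
        have h : genB⁻¹ * genA ^ n = genA ^ (2 * n) * genB⁻¹ := by
          rw [eq_mul_inv_iff_mul_eq, mul_assoc, genA_zpow_mul_genB, inv_mul_cancel_left]
        rw [pow_zero, one_mul, one_mul, ← mul_assoc, h, pow_succ genB, mul_inv_rev, mul_assoc]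
      | succ i =>
        refine ⟨i, j, n, ?_⟩
        rw [pow_succ' genB]; simp only [mul_assoc, inv_mul_cancel_left]

lemma genB_pow_image (i : ℕ) :
    (toRatAff (genB ^ i)).scale = (1 / 2) ^ i ∧ (toRatAff (genB ^ i)).shift = 0 := by
  rw [map_pow, toRatAff_genB]
  induction i with
  | zero => simp
  | succ i ih => rw [pow_succ, scale_mul, shift_mul, ih.1, ih.2, pow_succ]; simp

lemma genA_zpow_image (n : ℤ) :
    (toRatAff (genA ^ n)).scale = 1 ∧ (toRatAff (genA ^ n)).shift = n := by
  have h1 : (toRatAff genA).scale = 1 := by rw [toRatAff_genA]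
  have h2 : (toRatAff genA).shift = 1 := by rw [toRatAff_genA]
  rw [map_zpow]
  obtain ⟨m, rfl | rfl⟩ := n.eq_nat_or_neg
  · have := pow_of_scale_one h1 m
    rw [zpow_natCast, this.1, this.2, h2]
    simp
  · have := pow_of_scale_one h1 m
    rw [zpow_neg, zpow_natCast, scale_inv, shift_inv, this.1, this.2, h2]
    simp

/-- The element `b^i a^n b^(-j)` acts trivially only if `n = 0`, read from the shift, and `i = j`,
read from the scale. -/
theorem toRatAff_injective : Function.Injective toRatAff := by
  rw [injective_iff_map_eq_one]
  intro g hg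
  obtain ⟨i, j, n, rfl⟩ := exists_normal_form g
  have hg' : toRatAff (genB ^ i) * toRatAff (genA ^ n) = toRatAff (genB ^ j) := by
    rw [← map_mul, ← mul_inv_eq_one, ← map_inv, ← map_mul, hg]
  have h1 := congrArg scale hg'
  have h2 := congrArg shift hg'
  simp only [scale_mul, shift_mul, (genB_pow_image _).1, (genB_pow_image _).2,
    (genA_zpow_image n).1, (genA_zpow_image n).2, mul_one, zero_add] at h1 h2
  have hn : n = 0 := by
    rcases mul_eq_zero.1 h2 with h | h
    · exact absurd h (by positivity)
    · exact_mod_cast h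
  have hij : i = j := pow_right_injective₀ (by norm_num : (0 : ℚ) < 1 / 2) (by norm_num) h1
  rw [hn, hij]; simp

theorem exists_isGroupOrder : ∃ o : LinearOrder BS12, IsGroupOrder o := by
  refine ⟨LinearOrder.lift' toRatAff toRatAff_injective, fun a b x y h => ?_⟩
  change toRatAff (x * a * y) ≤ toRatAff (x * b * y)
  have h' : toRatAff a ≤ toRatAff b := h
  simp only [map_mul]
  gcongr

/-- Generation matters only through this consequence: commuting generators would make `a` and `b`
commute. -/
lemma noncomm_of_closure_eq_top {S : Set BS12} (hS : S.Finite) (h : Subgroup.closure S = ⊤) :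
    Noncomm (imageFinset toRatAff hS) := by
  by_contra hn
  rw [not_noncomm] at hn
  have hc : ∀ x ∈ S, ∀ y ∈ S, x * y = y * x := by
    intro x hx y hy
    apply toRatAff_injective
    rw [map_mul, map_mul]
    exact hn _ ((map_mem_imageFinset toRatAff_injective hS).2 hx) _
      ((map_mem_imageFinset toRatAff_injective hS).2 hy)
  have hall : ∀ x y : BS12, x * y = y * x := by
    intro x y
    have hx : x ∈ Subgroup.closure S := by rw [h]; trivial
    have hy : y ∈ Subgroup.closure S := by rw [h]; trivial
    exact congrArg Subtype.val
      ((Subgroup.isMulCommutative_closure hc).is_comm.comm ⟨x, hx⟩ ⟨y, hy⟩)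
  have := congrArg (fun g => (toRatAff g).shift) (hall genA genB)
  simp only [map_mul, toRatAff_genA, toRatAff_genB, shift_mul] at this
  norm_num at this

end BS12

/-! ### The characterization in BS(1,2). -/

theorem theorem3 :
    (∃ o : LinearOrder BS12, IsGroupOrder o) ∧
    ∀ o : LinearOrder BS12, IsGroupOrder o →
      ∀ S : Set BS12, S.Finite → Subgroup.closure S = ⊤ →
        (4 < S.ncard →
          ((S * S).ncard = 3 * S.ncard - 2 ↔
            ∃ x c : BS12, o.lt 1 c ∧ DoublingRel c x ∧ S = geomProg x c S.ncard)) ∧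
        (S.ncard = 4 →
          ((S * S).ncard = 3 * S.ncard - 2 ↔
            (∃ x c : BS12, DoublingRel c x ∧ S = {1, c, c ^ 2, x}) ∨
            (∃ x c : BS12, o.lt 1 c ∧ DoublingRel c x ∧
              S = {x, x * c, x * c ^ 2, x * c ^ 3}))) := by
  refine ⟨BS12.exists_isGroupOrder, fun o ho S hS hgen => ?_⟩
  have hφ := BS12.toRatAff_injective
  have hn := BS12.noncomm_of_closure_eq_top hS hgen
  have lower := three_mul_ncard_sub_two_le hφ hS hn
  have upper : 4 ≤ S.ncard → (S * S).ncard = 3 * S.ncard - 2 →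
      RatAff.IsProg (imageFinset BS12.toRatAff hS) ∨
        S.ncard = 4 ∧ RatAff.IsTri (imageFinset BS12.toRatAff hS) := fun h4 h =>
    RatAff.classified h4 _ (card_imageFinset hφ hS) hn
      (by rw [card_imageFinset_mul hφ]; omega)
  have prog : 4 ≤ S.ncard → RatAff.IsProg (imageFinset BS12.toRatAff hS) →
      ∃ x c : BS12, o.lt 1 c ∧ DoublingRel c x ∧ S = geomProg x c S.ncard := by
    intro h4 hP
    obtain ⟨x, c, hc, hd, hSeq⟩ := exists_geomProg_of_isProg hφ hS (by omega) hP
    -- The given order is used only here, to replace `c` by its inverse if necessary.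
    obtain ⟨x', c', h1, h2, h3⟩ := exists_geomProg_one_lt ho (k := S.ncard) (by omega) hc hd
    exact ⟨x', c', h1, h2, hSeq.trans h3⟩
  have conv : ∀ x c : BS12, DoublingRel c x → S = geomProg x c S.ncard →
      (S * S).ncard = 3 * S.ncard - 2 := by
    intro x c hd hSeq
    refine le_antisymm ?_ lower
    have := ncard_geomProg_mul_le hd S.ncard
    rwa [← hSeq] at this
  have four : ∀ x c : BS12, geomProg x c 4 = {x, x * c, x * c ^ 2, x * c ^ 3} := by
    intro x c
    ext g
    simp only [geomProg, Set.mem_ofPred_eq, Set.mem_insert_iff, Set.mem_singleton_iff]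
    constructor
    · rintro ⟨i, hi, rfl⟩
      interval_cases i <;> simp
    · rintro (rfl | rfl | rfl | rfl)
      exacts [⟨0, by simp⟩, ⟨1, by simp⟩, ⟨2, by simp⟩, ⟨3, by simp⟩]
  refine ⟨fun hk => ⟨fun h => ?_, fun ⟨x, c, _, hd, hSeq⟩ => conv x c hd hSeq⟩,
    fun hk => ⟨fun h => ?_, ?_⟩⟩
  · rcases upper hk.le h with hP | ⟨h4, -⟩
    · exact prog hk.le hP
    · omega
  · rcases upper hk.ge h with hP | ⟨-, hT⟩
    · obtain ⟨x, c, h1, h2, h3⟩ := prog hk.ge hP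
      rw [hk, four] at h3
      exact Or.inr ⟨x, c, h1, h2, h3⟩
    · exact Or.inl (exists_triple_of_isTri hφ hS hT)
  · rintro (⟨x, c, hd, hSeq⟩ | ⟨x, c, -, hd, hSeq⟩)
    · refine le_antisymm ?_ lower
      rw [hk]
      have := ncard_triple_mul_le hd
      rwa [← hSeq] at this
    · exact conv x c hd (by rw [hk, four]; exact hSeq)
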